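/- Let $\sigma>0$, $0<D<\sigma^2$, $P>0$ and $\varepsilon\in(0,1)$. Let $S$ and $Z$ be real random variables with arbitrary laws such that $\mathsf E[S^2]=\sigma^2$, $\mathsf E[S^6]<\infty$, $\mathsf E[Z^2]=1$, $\mathsf E[Z^6]<\infty$. A memoryless source $S^k$ (i.i.d. copies of $S$) is sent over the additive channel $Y^n=X^n+Z^n$ ($Z^n$ i.i.d. copies of $Z$) by the following NN-JSCC scheme. Write $d(x,y)=\frac1k\|x-y\|^2$ for $x,y\in\mathbb R^k$; logarithms are natural. *Codebook laws.* For $\dagger\in\{\mathrm{sp},\mathrm{iid}\}$, a random codeword of length $m$ and power $q$ of type $\dagger$ is uniform on the sphere of radius $\sqrt{mq}$ in $\mathbb R^m$ if $\dagger=\mathrm{sp}$, and has i.i.d. $\mathcal N(0,q)$ coordinates if $\dagger=\mathrm{iid}$. *Parameters.* For $k\ge1$ let $\xi=\sqrt{\log k/k}$, $N=\lceil 2k\xi\rceil$, $\Upsilon(i)=(1-\xi+\frac ik)\sigma^2$ for $0\le i\le N$, and $\mathcal T_i=\{s\in\mathbb R^k:\Upsilon(i-1)\le\|s\|^2/k<\Upsilon(i)\}$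 for $1\le i\le N$. Let $\Psi_\dagger(k,p)$ be the probability that $d(s,\hat S^k)\le D$, where $\|s\|^2/k=p$ and $\hat S^k$ is a random codeword of length $k$, power $\sigma^2-D$ and type $\dagger$ (this depends on $s$ only through $p$). Let $M_i=\lceil k/\Psi_\dagger(k,\Upsilon(i))\rceil$, that is, $\log M_i=-\log\Psi_\dagger(k,\Upsilon(i))+\log k$ up to rounding; if $\Psi_\dagger(k,\Upsilon(i))=0$, put $M_i=0$. *Codebooks.* For all $1\le i\le N$, $1\le j\le M_i$, draw source codewords $\hat S^k(i,j)$ of length $k$, power $\sigma^2-D$ and type $\dagger$, and channel codewords $X^n(i,j)$ of length $n$, power $P$ and type $\ddagger$. All of them, the source and the noise are independent. *Encoder.* If $S^k\in\mathcal T_I$ with $M_I>0$, let $J=\arg\min_{1\le j\le M_I}\|S^k-\hat S^k(I,j)\|^2$ and send $X^n(I,J)$. Otherwise an error is declared. *Decoder.* Reproduce $\hat S^k(\hat I,\hat J)$, where $(\hat I,\hat J)=\arg\min_{(i,j)}\|X^n(i,j)-Y^n\|^2+2\log M_i$ over all $1\le i\le N$, $1\le j\le M_i$. Ties, in the encoder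 and the decoder, are resolved in favour of the (lexicographically) smallest index. Let $\mathrm P_{\mathrm e,k,n}$ be the ensemble excess-distortion probability, that is, the probability (over source, noise and both codebooks) that the encoder declares an error or $d(S^k,\hat S^k(\hat I,\hat J))>D$. Let $k^*_{\dagger,\ddagger}(n,\varepsilon)$ be the largest $k\ge1$ with $\mathrm P_{\mathrm e,k,n}\le\varepsilon$ (and $0$ if there is no largest such $k$). Then for every $(\dagger,\ddagger)\in\{\mathrm{sp},\mathrm{iid}\}^2$ the maximum in the definition of $k^*_{\dagger,\ddagger}(n,\varepsilon)$ exists for all sufficiently large $n$, and $$\lim_{n\to\infty}\frac{k^*_{\dagger,\ddagger}(n,\varepsilon)}{n}=\frac{\mathrm C(P)}{\mathrm R(\sigma^2,D)},\qquad \mathrm C(P)=\tfrac12\log(1+P),\quad \mathrm R(\sigma^2,D)=\max\{\tfrac12\log\tfrac{\sigma^2}{D},0\}.$$ -/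

import Mathlib

open MeasureTheory ProbabilityTheory Filter Topology

noncomputable section

namespace NNJSCC

/-- Real vectors of length `m` with the Euclidean norm. -/
abbrev Vec (m : ℕ) : Type := EuclideanSpace ℝ (Fin m)

/-- The normalized quadratic distortion `d(x, y) = ‖x - y‖² / m`. -/
def distortion {m : ℕ} (x y : Vec m) : ℝ := ‖x - y‖ ^ 2 / m

/-- The Gaussian capacity function (in nats). -/
def capacity (P : ℝ) : ℝ := Real.log (1 + P) / 2

/-- The Gaussian rate-distortion function (in nats); the first argument is the variance. -/
def rateDistortion (v D : ℝ) : ℝ := max (Real.log (v / D) / 2) 0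

/-! ### Laws of the random vectors -/

/-- The law of a vector of `m` independent coordinates, each with law `μ`. -/
def iidLaw (μ : Measure ℝ) (m : ℕ) : Measure (Vec m) :=
  (Measure.pi fun _ : Fin m => μ).map (WithLp.toLp 2)

/-- The uniform law on the sphere of radius `r` about the origin of `ℝ^m`: the normalized surface
measure of the unit sphere, scaled by `r`. -/
def uniformSphere (r : ℝ) (m : ℕ) : Measure (Vec m) :=
  (ProbabilityTheory.cond ((volume : Measure (Vec m)).toSphere) Set.univ).map
    fun x : Metric.sphere (0 : Vec m) 1 => r • (x : Vec m)

/-- The two types of random codebooks: spherical and i.i.d. Gaussian. -/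
inductive Codebook : Type
  | sp
  | iid

/-- The law of one codeword of length `m` and power `q`: uniform on the sphere of radius
`√(m q)`, or with independent centred Gaussian coordinates of variance `q`. -/
def codewordLaw (c : Codebook) (q : ℝ) (m : ℕ) : Measure (Vec m) :=
  match c with
  | .sp => uniformSphere (Real.sqrt (m * q)) m
  | .iid => iidLaw (gaussianReal 0 q.toNNReal) m

/-! ### The code, for given power levels and sub-codebook sizes -/

/-- The message set: pairs of a power type and an index in the sub-codebook of that type, in
lexicographic order. -/
abbrev Message {N : ℕ} (M : Fin N → ℕ) : Type := Σₗ i : Fin N, Fin (M i)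

/-- The minimizer of `g`; the smallest one if there are several. -/
def argMin {ι : Type} [Fintype ι] [LinearOrder ι] [Nonempty ι] (g : ι → ℝ) : ι :=
  (Finset.univ.filter fun a => ∀ b, g a ≤ g b).min' <| by
    obtain ⟨a, ha⟩ := Finite.exists_min g
    exact ⟨a, by simpa using ha⟩

/-- The `i`-th power type class among `i = 0, …, N - 1`, with power levels
`level 0 ≤ level 1 ≤ … ≤ level N`. -/
def typeClass (k : ℕ) (level : ℕ → ℝ) (i : ℕ) : Set (Vec k) :=
  {s | level i ≤ ‖s‖ ^ 2 / k ∧ ‖s‖ ^ 2 / k < level (i + 1)}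

open Classical in
/-- The source encoder: the power type of `s` together with the index of the closest source codeword
in the sub-codebook of this type. It declares an error (`none`) if `s` lies in no power type class
(or if the sub-codebook of its type is empty). -/
def encode {k N : ℕ} (level : ℕ → ℝ) (M : Fin N → ℕ) (s : Vec k) (src : Message M → Vec k) :
    Option (Message M) :=
  if h : ∃ i : Fin N, s ∈ typeClass k level i ∧ 0 < M i then
    haveI : Nonempty (Fin (M h.choose)) := ⟨⟨0, h.choose_spec.2⟩⟩
    some (toLex ⟨h.choose, argMin fun j => ‖s - src (toLex ⟨h.choose, j⟩)‖ ^ 2⟩)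
  else none

/-- The regularized nearest neighbor channel decoder. -/
def decode {n N : ℕ} (M : Fin N → ℕ) [Nonempty (Message M)] (chan : Message M → Vec n)
    (y : Vec n) : Message M :=
  argMin fun m => ‖chan m - y‖ ^ 2 + 2 * Real.log (M (ofLex m).1)

/-- The excess-distortion event for the source sequence `s`, the source codebook `src`, the channel
codebook `chan` and the noise `z`: the encoder declares an error, or the source codeword of the
message decoded from the channel output is at distortion more than `D` from `s`. -/
def Excess {k n N : ℕ} (level : ℕ → ℝ) (M : Fin N → ℕ) (D : ℝ) (s : Vec k)
    (src : Message M → Vec k) (chan : Message M → Vec n) (z : Vec n) : Prop :=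
  match encode level M s src with
  | none => True
  | some m =>
    haveI : Nonempty (Message M) := ⟨m⟩
    D < distortion s (src (decode M chan (chan m + z)))

/-! ### The choice of the parameters -/

/-- The quantization range `ξ = √(log k / k)`. -/
def xi (k : ℕ) : ℝ := Real.sqrt (Real.log k / k)

/-- The number of power types. -/
def numTypes (k : ℕ) : ℕ := ⌈2 * k * xi k⌉₊

/-- The power levels `Υ(i)`. -/
def powerLevel (σ : ℝ) (k i : ℕ) : ℝ := (1 - xi k + (i : ℝ) / k) * σ ^ 2

/-- The probability that a random source codeword is within distortion `D` of a fixed sequence `s`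
with `‖s‖² / k = p`. The laws of the codewords are invariant under rotations, so that any such `s`
may be taken; here all its coordinates are `√p`. -/
def nonExcessProb (c : Codebook) (σ D : ℝ) (k : ℕ) (p : ℝ) : ℝ :=
  (codewordLaw c (σ ^ 2 - D) k).real
    {w | distortion (WithLp.toLp 2 fun _ => Real.sqrt p) w ≤ D}

/-- The sub-codebook sizes: `log M_i = - log Ψ(k, Υ(i)) + log k`, rounded up to an integer. The class
with index `i` here lies between the levels `Υ(i)` and `Υ(i + 1)`. -/
def codebookSize (c : Codebook) (σ D : ℝ) (k : ℕ) (i : Fin (numTypes k)) : ℕ :=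
  ⌈(k : ℝ) / nonExcessProb c σ D k (powerLevel σ k (i + 1))⌉₊

/-! ### The ensemble excess-distortion probability and its fundamental limit -/

/-- The probability of excess distortion over the memoryless source with letter law `μS`, the random
source codebook (type `cs`, codewords of power `σ² - D`), the random channel codebook (type `cc`,
codewords of power `P`) and the memoryless noise with letter law `μZ`, all independent. -/
def excessProb (μS μZ : Measure ℝ) (cs cc : Codebook) (P σ D : ℝ) (k n : ℕ) : ℝ :=
  ((iidLaw μS k).prod
    ((Measure.pi fun _ : Message (codebookSize cs σ D k) => codewordLaw cs (σ ^ 2 - D) k).prod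
      ((Measure.pi fun _ : Message (codebookSize cs σ D k) => codewordLaw cc P n).prod
        (iidLaw μZ n)))).real
    {ω | Excess (powerLevel σ k) (codebookSize cs σ D k) D ω.1 ω.2.1 ω.2.2.1 ω.2.2.2}

/-- The lengths of the source sequences that `n` channel uses convey with ensemble
excess-distortion probability at most `ε`. -/
def feasible (μS μZ : Measure ℝ) (cs cc : Codebook) (P σ D ε : ℝ) (n : ℕ) : Set ℕ :=
  {k | 1 ≤ k ∧ excessProb μS μZ cs cc P σ D k n ≤ ε}

/-- The maximal number of source symbols that `n` channel uses convey with ensemble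
excess-distortion probability at most `ε` (`0` if there is no maximum). -/
def kStar (μS μZ : Measure ℝ) (cs cc : Codebook) (P σ D ε : ℝ) (n : ℕ) : ℕ :=
  sSup (feasible μS μZ cs cc P σ D ε n)

end NNJSCC

end

noncomputable section

namespace NNJSCC

/-! ### Gaussian vectors -/

/-! Everything rests on one exponential estimate, uniform in the centre and valid for both codebook
types: if `y` has power close to `q + D`, a random codeword of length `m` and power `q` lands within
squared distance about `m D` of `y` with probability `exp (-m (log ((q + D) / D) / 2 + o(1)))`
(`eventually_codewordLaw_ball_le`, `eventually_le_codewordLaw_ball`). For Gaussian codewords this is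
a change of measure to a Gaussian law centred near `(q / (q + D)) • y`. A spherical codeword is a
normalized Gaussian vector whose direction is independent of its norm, so it inherits the estimate.

The estimate is used twice. For the source, `q = σ² - D` and the exponent is the rate `R`; hence
`log M_i = k R + o(k)` uniformly in `i`. For the channel, `q = P`, the noise power `1` takes the
place of `D`, and `y` is the channel output; the exponent is the capacity `C` for a competitor to
come as close to the output as the codeword sent. Only the concentration of `‖S^k‖²` and `‖Z^n‖²`
enters, which is why the laws of `S` and `Z` are arbitrary.

Below capacity (`eventually_excessProb_le`) take `k = ⌊c n⌋` with `c R < C`. The source has a power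
type by Chebyshev's inequality. Its sub-codebook misses the distortion ball with probability at most
`exp (-k)`, because `M_i` is at least `k` over the ball probability. A union bound over at most `2 k
exp (k (R + o(1)))` messages makes the decoder reliable, since the regularizers of any two messages
differ only by `o(n)`.

Above capacity (`eventually_lt_excessProb`) some message of the same type, hence with the same
regularizer, almost surely beats the one sent. A wrong message could still reproduce a good
codeword. But the channel codebook is independent of the source codebook, and a codeword that the
encoder did not choose is close to the source with at most the probability of a fresh codeword
(`pi_real_nearest_inter_le`), which is exponentially small. So the failure probability tends to one,
uniformly in `k ≥ c n`. This bounds the feasible set and gives the upper half of the limit. -/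

/-- The law of a vector of `m` independent centred Gaussian coordinates of variance `q`. -/
abbrev gaussLaw (q : ℝ) (m : ℕ) : Measure (Vec m) := iidLaw (gaussianReal 0 q.toNNReal) m

instance isProbabilityMeasure_iidLaw (μ : Measure ℝ) [IsProbabilityMeasure μ] (m : ℕ) :
    IsProbabilityMeasure (iidLaw μ m) :=
  Measure.isProbabilityMeasure_map (by fun_prop)

/-- The density of `gaussLaw q m` as a function of the norm. -/
def gaussDensity (q : ℝ) (m : ℕ) (t : ℝ) : ℝ :=
  (Real.sqrt (2 * Real.pi * q))⁻¹ ^ m * Real.exp (-t ^ 2 / (2 * q))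

lemma measurable_gaussDensity (q : ℝ) (m : ℕ) : Measurable (gaussDensity q m) := by
  unfold gaussDensity; fun_prop

lemma measurable_gaussDensity_sub (q : ℝ) {m : ℕ} (b : Vec m) :
    Measurable fun w : Vec m => ENNReal.ofReal (gaussDensity q m ‖w - b‖) :=
  ((measurable_gaussDensity q m).comp (measurable_id.sub_const b).norm).ennreal_ofReal

lemma measurable_gaussDensity_norm (q : ℝ) {m : ℕ} :
    Measurable fun w : Vec m => ENNReal.ofReal (gaussDensity q m ‖w‖) := by
  simpa using measurable_gaussDensity_sub q (0 : Vec m)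

lemma pi_gaussianReal_eq_withDensity {q : ℝ} (hq : 0 < q) (m : ℕ) :
    (Measure.pi fun _ : Fin m => gaussianReal 0 q.toNNReal) =
      volume.withDensity fun x : Fin m → ℝ =>
        ENNReal.ofReal (∏ i, gaussianPDFReal 0 q.toNNReal (x i)) := by
  have hq' : q.toNNReal ≠ 0 := by simpa using hq
  refine Measure.pi_eq fun s hs => ?_
  rw [withDensity_apply _ (MeasurableSet.univ_pi hs), volume_pi, Measure.restrict_pi_pi,
    ← ofReal_integral_eq_lintegral_ofReal
      (Integrable.fintype_prod fun i => (integrable_gaussianPDFReal 0 q.toNNReal).restrict)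
      (ae_of_all _ fun x => Finset.prod_nonneg fun i _ => gaussianPDFReal_nonneg _ _ _),
    integral_fintype_prod_eq_prod,
    ENNReal.ofReal_prod_of_nonneg fun i _ => integral_nonneg fun x => gaussianPDFReal_nonneg _ _ _]
  exact Finset.prod_congr rfl fun i _ => (gaussianReal_apply_eq_integral 0 hq' (s i)).symm

lemma gaussLaw_eq_withDensity {q : ℝ} (hq : 0 < q) (m : ℕ) :
    gaussLaw q m = volume.withDensity fun w => ENNReal.ofReal (gaussDensity q m ‖w‖) := by
  have hmp := PiLp.volume_preserving_toLp (ι := Fin m)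
  ext A hA
  rw [gaussLaw, iidLaw, pi_gaussianReal_eq_withDensity hq, Measure.map_apply (by fun_prop) hA,
    withDensity_apply _ (hmp.measurable hA), withDensity_apply _ hA,
    ← hmp.setLIntegral_comp_preimage hA (measurable_gaussDensity_norm q)]
  refine lintegral_congr fun x => ?_
  congr 1
  simp only [gaussDensity, gaussianPDFReal, Finset.prod_mul_distrib, ← Real.exp_sum,
    Real.coe_toNNReal _ hq.le, EuclideanSpace.norm_sq_eq]
  simp [Finset.sum_div, neg_div]

lemma measurePreserving_gaussLaw {q : ℝ} (hq : 0 < q) {m : ℕ} (L : Vec m ≃ₗᵢ[ℝ] Vec m) :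
    MeasurePreserving L (gaussLaw q m) (gaussLaw q m) := by
  refine ⟨L.continuous.measurable, ?_⟩
  ext A hA
  rw [Measure.map_apply L.continuous.measurable hA, gaussLaw_eq_withDensity hq,
    withDensity_apply _ (L.continuous.measurable hA), withDensity_apply _ hA,
    ← L.measurePreserving.setLIntegral_comp_preimage hA (measurable_gaussDensity_norm q)]
  simp

lemma gaussLaw_apply_shift {q : ℝ} (hq : 0 < q) {m : ℕ} (b : Vec m) {A : Set (Vec m)}
    (hA : MeasurableSet A) :
    gaussLaw q m {g | b + g ∈ A} = ∫⁻ w in A, ENNReal.ofReal (gaussDensity q m ‖w - b‖) := by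
  have hmp := measurePreserving_add_left (volume : Measure (Vec m)) b
  change gaussLaw q m ((fun g => b + g) ⁻¹' A) = _
  rw [gaussLaw_eq_withDensity hq, withDensity_apply _ (hmp.measurable hA),
    ← hmp.setLIntegral_comp_preimage hA (measurable_gaussDensity_sub q b)]
  simp only [add_sub_cancel_left]

lemma gaussDensity_le {q τ K s t : ℝ} (hq : 0 < q) (hτ : 0 < τ) (m : ℕ)
    (h : -s ^ 2 / (2 * q) ≤ K - t ^ 2 / (2 * τ)) :
    gaussDensity q m s ≤ (Real.sqrt (τ / q) ^ m * Real.exp K) * gaussDensity τ m t := by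
  have h1 : (Real.sqrt (2 * Real.pi * q))⁻¹ =
      Real.sqrt (τ / q) * (Real.sqrt (2 * Real.pi * τ))⁻¹ := by
    rw [← Real.sqrt_inv, ← Real.sqrt_inv, ← Real.sqrt_mul (by positivity)]
    congr 1
    field_simp
  rw [gaussDensity, gaussDensity, h1, mul_pow, mul_mul_mul_comm, ← Real.exp_add]
  refine mul_le_mul_of_nonneg_left (Real.exp_le_exp.2 ?_) (by positivity)
  linarith [neg_div (2 * τ) (t ^ 2)]

lemma le_gaussDensity {q τ K s t : ℝ} (hq : 0 < q) (hτ : 0 < τ) (m : ℕ)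
    (h : K - t ^ 2 / (2 * τ) ≤ -s ^ 2 / (2 * q)) :
    (Real.sqrt (τ / q) ^ m * Real.exp K) * gaussDensity τ m t ≤ gaussDensity q m s := by
  have h1 : (Real.sqrt (2 * Real.pi * q))⁻¹ =
      Real.sqrt (τ / q) * (Real.sqrt (2 * Real.pi * τ))⁻¹ := by
    rw [← Real.sqrt_inv, ← Real.sqrt_inv, ← Real.sqrt_mul (by positivity)]
    congr 1
    field_simp
  rw [gaussDensity, gaussDensity, h1, mul_pow, mul_mul_mul_comm, ← Real.exp_add]
  refine mul_le_mul_of_nonneg_left (Real.exp_le_exp.2 ?_) (by positivity)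
  linarith [neg_div (2 * τ) (t ^ 2)]

/-- Change of measure: `q` is the true variance, while `τ` and the centre `b` define a reference
Gaussian law that can be adapted to `A`. The hypothesis compares the exponents, and `√(τ / q) ^ m`
is the ratio of the normalizing constants. -/
lemma gaussLaw_le_of_density_le {q τ K : ℝ} (hq : 0 < q) (hτ : 0 < τ) {m : ℕ} (b : Vec m)
    {A : Set (Vec m)} (hA : MeasurableSet A)
    (h : ∀ w ∈ A, -‖w‖ ^ 2 / (2 * q) ≤ K - ‖w - b‖ ^ 2 / (2 * τ)) :
    (gaussLaw q m).real A ≤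
      Real.sqrt (τ / q) ^ m * Real.exp K * (gaussLaw τ m).real {g | b + g ∈ A} := by
  have hc : 0 ≤ Real.sqrt (τ / q) ^ m * Real.exp K := by positivity
  rw [measureReal_def, measureReal_def, ← ENNReal.toReal_ofReal hc, ← ENNReal.toReal_mul]
  refine ENNReal.toReal_mono (ENNReal.mul_ne_top ENNReal.ofReal_ne_top (measure_ne_top _ _)) ?_
  rw [gaussLaw_apply_shift hτ b hA, gaussLaw_eq_withDensity hq, withDensity_apply _ hA,
    ← lintegral_const_mul _ (measurable_gaussDensity_sub τ b)]
  refine setLIntegral_mono' hA fun w hw => ?_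
  rw [← ENNReal.ofReal_mul hc]
  exact ENNReal.ofReal_le_ofReal (gaussDensity_le hq hτ m (h w hw))

lemma le_gaussLaw_of_le_density {q τ K : ℝ} (hq : 0 < q) (hτ : 0 < τ) {m : ℕ} (b : Vec m)
    {A : Set (Vec m)} (hA : MeasurableSet A)
    (h : ∀ w ∈ A, K - ‖w - b‖ ^ 2 / (2 * τ) ≤ -‖w‖ ^ 2 / (2 * q)) :
    Real.sqrt (τ / q) ^ m * Real.exp K * (gaussLaw τ m).real {g | b + g ∈ A} ≤
      (gaussLaw q m).real A := by
  have hc : 0 ≤ Real.sqrt (τ / q) ^ m * Real.exp K := by positivity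
  rw [measureReal_def, measureReal_def, ← ENNReal.toReal_ofReal hc, ← ENNReal.toReal_mul]
  refine ENNReal.toReal_mono (measure_ne_top _ _) ?_
  rw [gaussLaw_apply_shift hτ b hA, gaussLaw_eq_withDensity hq, withDensity_apply _ hA,
    ← lintegral_const_mul _ (measurable_gaussDensity_sub τ b)]
  refine setLIntegral_mono' hA fun w hw => ?_
  rw [← ENNReal.ofReal_mul hc]
  exact ENNReal.ofReal_le_ofReal (le_gaussDensity hq hτ m (h w hw))

/-! ### The uniform law on the sphere -/

/-- The norm and the direction of a Gaussian vector are independent, and the direction is uniform. -/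
lemma gaussLaw_polar {q : ℝ} (hq : 0 < q) {m : ℕ} (hm : 0 < m) (r : ℝ) {A : Set (Vec m)}
    (hA : MeasurableSet A) {I : Set ℝ} (hI : MeasurableSet I) :
    gaussLaw q m {w | (r / ‖w‖) • w ∈ A ∧ ‖w‖ ∈ I} =
      uniformSphere r m A * gaussLaw q m {w | ‖w‖ ∈ I} := by
  have : Nonempty (Fin m) := ⟨⟨0, hm⟩⟩
  have : Nontrivial (Vec m) := inferInstance
  set T := (volume : Measure (Vec m)).toSphere with hT
  set V := Measure.volumeIoiPow (Module.finrank ℝ (Vec m) - 1) with hV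
  set c := ∫⁻ ρ : Set.Ioi (0 : ℝ), I.indicator 1 (ρ : ℝ) * ENNReal.ofReal (gaussDensity q m ρ) ∂V
    with hc
  have hmeas : Measurable fun x : Metric.sphere (0 : Vec m) 1 => r • (x : Vec m) := by fun_prop
  have hmul : Measurable fun w : Vec m => (r / ‖w‖) • w := by fun_prop
  -- In polar coordinates the integral factors, and the radial factor `c` does not involve `B`. The
  -- choice `B = univ` then identifies `c` up to the total surface mass.
  have key : ∀ B : Set (Vec m), MeasurableSet B →
      gaussLaw q m {w | (r / ‖w‖) • w ∈ B ∧ ‖w‖ ∈ I} =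
        T {u | r • (u : Vec m) ∈ B} * c := by
    intro B hB
    have hS : MeasurableSet {w : Vec m | (r / ‖w‖) • w ∈ B ∧ ‖w‖ ∈ I} :=
      (hmul hB).inter (measurable_norm hI)
    have hmp := (volume : Measure (Vec m)).measurePreserving_homeomorphUnitSphereProd
    rw [gaussLaw_eq_withDensity hq, withDensity_apply _ hS, ← lintegral_indicator hS,
      ← setLIntegral_univ, ← Set.union_compl_self ({0} : Set (Vec m))]
    -- Polar coordinates parametrize the complement of the origin, which is a null set.
    rw [lintegral_union (measurableSet_singleton _).compl disjoint_compl_right,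
      setLIntegral_measure_zero _ _ (measure_singleton _), zero_add,
      ← lintegral_subtype_comap (measurableSet_singleton _).compl]
    have hf : Measurable fun p : Metric.sphere (0 : Vec m) 1 × Set.Ioi (0 : ℝ) =>
        ({u : Metric.sphere (0 : Vec m) 1 | r • (u : Vec m) ∈ B}.indicator 1 p.1 : ENNReal) *
        (I.indicator 1 (p.2 : ℝ) * ENNReal.ofReal (gaussDensity q m p.2)) := by
      have h1 : Measurable ({u : Metric.sphere (0 : Vec m) 1 | r • (u : Vec m) ∈ B}.indicator
        (1 : Metric.sphere (0 : Vec m) 1 → ENNReal)) := measurable_one.indicator (hmeas hB)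
      have h2 : Measurable (I.indicator (1 : ℝ → ENNReal)) := measurable_one.indicator hI
      have h3 := (measurable_gaussDensity q m).ennreal_ofReal
      exact (h1.comp measurable_fst).mul ((h2.comp (measurable_subtype_coe.comp measurable_snd)).mul
        (h3.comp (measurable_subtype_coe.comp measurable_snd)))
    have h1 : T {u | r • (u : Vec m) ∈ B} * c =
        ∫⁻ p, ({u : Metric.sphere (0 : Vec m) 1 | r • (u : Vec m) ∈ B}.indicator 1 p.1 : ENNReal) *
        (I.indicator 1 (p.2 : ℝ) * ENNReal.ofReal (gaussDensity q m p.2)) ∂(T.prod V) := by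
      rw [lintegral_prod_mul (f := {u : Metric.sphere (0 : Vec m) 1 |
          r • (u : Vec m) ∈ B}.indicator (1 : Metric.sphere (0 : Vec m) 1 → ENNReal))
          (g := fun ρ : Set.Ioi (0 : ℝ) => I.indicator 1 (ρ : ℝ) *
          ENNReal.ofReal (gaussDensity q m ρ)),
          lintegral_indicator_one (s := {u : Metric.sphere (0 : Vec m) 1 | r • (u : Vec m) ∈ B})
            (hmeas hB)]
      · exact (measurable_one.indicator (hmeas hB)).aemeasurable
      · have h2 : Measurable (I.indicator (1 : ℝ → ENNReal)) := measurable_one.indicator hI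
        have h3 := (measurable_gaussDensity q m).ennreal_ofReal
        exact ((h2.comp measurable_subtype_coe).mul
          (h3.comp measurable_subtype_coe)).aemeasurable
    rw [h1, ← hmp.lintegral_comp hf]
    refine lintegral_congr fun w => ?_
    have hn : ((homeomorphUnitSphereProd (Vec m) w).2 : ℝ) = ‖(w : Vec m)‖ := by simp
    have hd : r • ((homeomorphUnitSphereProd (Vec m) w).1 : Vec m) =
        (r / ‖(w : Vec m)‖) • (w : Vec m) := by
      simp [smul_smul, div_eq_mul_inv]
    have h1 : ({u : Metric.sphere (0 : Vec m) 1 | r • (u : Vec m) ∈ B}.indicator 1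
        (homeomorphUnitSphereProd (Vec m) w).1 : ENNReal) =
        {w : Vec m | (r / ‖w‖) • w ∈ B}.indicator 1 (w : Vec m) := by
      have hiff : (homeomorphUnitSphereProd (Vec m) w).1 ∈
          {u : Metric.sphere (0 : Vec m) 1 | r • (u : Vec m) ∈ B} ↔
          (w : Vec m) ∈ {w : Vec m | (r / ‖w‖) • w ∈ B} := by
        simp only [Set.mem_ofPred_eq, hd]
      by_cases h : (w : Vec m) ∈ {w : Vec m | (r / ‖w‖) • w ∈ B}
      · rw [Set.indicator_of_mem (hiff.2 h), Set.indicator_of_mem h]; rfl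
      · rw [Set.indicator_of_notMem (mt hiff.1 h), Set.indicator_of_notMem h]
    rw [h1, hn]
    by_cases ha : (r / ‖(w : Vec m)‖) • (w : Vec m) ∈ B <;>
      by_cases hb : ‖(w : Vec m)‖ ∈ I <;> simp [Set.indicator, ha, hb]
  have huniv := key Set.univ MeasurableSet.univ
  simp only [Set.mem_univ, true_and, Set.ofPred_true] at huniv
  have hT0 : T Set.univ ≠ 0 :=
    Measure.measure_univ_ne_zero.2 (Measure.toSphere_ne_zero _)
  rw [key A hA, huniv, uniformSphere, Measure.map_apply hmeas hA,
    ProbabilityTheory.cond_apply MeasurableSet.univ, Set.univ_inter, ← mul_assoc,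
    mul_right_comm _ _ (T Set.univ), ENNReal.inv_mul_cancel hT0 (measure_ne_top _ _), one_mul]
  rfl

lemma isProbabilityMeasure_uniformSphere (r : ℝ) {m : ℕ} (hm : 0 < m) :
    IsProbabilityMeasure (uniformSphere r m) := by
  have : Nonempty (Fin m) := ⟨⟨0, hm⟩⟩
  have : Nontrivial (Vec m) := inferInstance
  have : IsProbabilityMeasure (ProbabilityTheory.cond ((volume : Measure (Vec m)).toSphere)
    Set.univ) := cond_isProbabilityMeasure
      (Measure.measure_univ_ne_zero.2 (Measure.toSphere_ne_zero _))
  exact Measure.isProbabilityMeasure_map (by fun_prop)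

/-- A uniform vector on the sphere is a normalized Gaussian vector. -/
lemma uniformSphere_apply {q : ℝ} (hq : 0 < q) {m : ℕ} (hm : 0 < m) (r : ℝ) {A : Set (Vec m)}
    (hA : MeasurableSet A) :
    uniformSphere r m A = gaussLaw q m {w | (r / ‖w‖) • w ∈ A} := by
  simpa using (gaussLaw_polar hq hm r hA MeasurableSet.univ).symm

lemma measurePreserving_uniformSphere {m : ℕ} (hm : 0 < m) (r : ℝ) (L : Vec m ≃ₗᵢ[ℝ] Vec m) :
    MeasurePreserving L (uniformSphere r m) (uniformSphere r m) := by
  refine ⟨L.continuous.measurable, ?_⟩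
  ext A hA
  have hmul : Measurable fun w : Vec m => (r / ‖w‖) • w := by fun_prop
  rw [Measure.map_apply L.continuous.measurable hA,
    uniformSphere_apply one_pos hm r (L.continuous.measurable hA),
    uniformSphere_apply one_pos hm r hA,
    ← (measurePreserving_gaussLaw one_pos L).measure_preimage
      (show MeasurableSet {w : Vec m | (r / ‖w‖) • w ∈ A} from hmul hA).nullMeasurableSet]
  simp [Set.preimage]

lemma isProbabilityMeasure_codewordLaw (c : Codebook) (q : ℝ) {m : ℕ} (hm : 0 < m) :
    IsProbabilityMeasure (codewordLaw c q m) := by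
  cases c with
  | sp => exact isProbabilityMeasure_uniformSphere _ hm
  | iid => exact isProbabilityMeasure_iidLaw _ _

lemma measurePreserving_codewordLaw (c : Codebook) {q : ℝ} (hq : 0 < q) {m : ℕ} (hm : 0 < m)
    (L : Vec m ≃ₗᵢ[ℝ] Vec m) :
    MeasurePreserving L (codewordLaw c q m) (codewordLaw c q m) := by
  cases c with
  | sp => exact measurePreserving_uniformSphere hm _ L
  | iid => exact measurePreserving_gaussLaw hq L

/-! ### Balls with centres of different norms -/

lemma measurableSet_norm_sub_sq_le {m : ℕ} (y : Vec m) (ρ : ℝ) :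
    MeasurableSet {w : Vec m | ‖y - w‖ ^ 2 ≤ ρ} :=
  measurableSet_le (by fun_prop) measurable_const

/-- The reflection in the hyperplane orthogonal to `s - t` carries `s` to `t` and preserves the law.
-/
lemma codewordLaw_ball_congr (c : Codebook) {q : ℝ} (hq : 0 < q) {m : ℕ} (hm : 0 < m)
    {s t : Vec m} (h : ‖s‖ = ‖t‖) (ρ : ℝ) :
    codewordLaw c q m {w | ‖s - w‖ ^ 2 ≤ ρ} = codewordLaw c q m {w | ‖t - w‖ ^ 2 ≤ ρ} := by
  set L := ((ℝ ∙ (s - t))ᗮ).reflection with hL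
  have hLs : L s = t := Submodule.reflection_sub h
  rw [← (measurePreserving_codewordLaw c hq hm L).measure_preimage
    (measurableSet_norm_sub_sq_le t ρ).nullMeasurableSet]
  congr 1
  ext w
  simp only [Set.mem_preimage, Set.mem_ofPred_eq]
  rw [← hLs, ← map_sub, L.norm_map]

lemma norm_smul_sub_sq {m : ℕ} (a : ℝ) (s w : Vec m) :
    ‖a • s - w‖ ^ 2 = a ^ 2 * ‖s‖ ^ 2 - 2 * a * inner ℝ s w + ‖w‖ ^ 2 := by
  rw [norm_sub_sq_real, norm_smul, inner_smul_left, mul_pow, Real.norm_eq_abs, sq_abs]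
  simp only [conj_trivial]
  ring

/-- Compare the two balls outside their intersection. The point reflection `w ↦ s + a • s - w`
exchanges the two differences, and it does not increase the norm of a point of `B' \ B`, since such
a point is nearer to `s` than to `a • s`. So it does not decrease the Gaussian density. -/
lemma gaussLaw_ball_smul_le {q : ℝ} (hq : 0 < q) {m : ℕ} {a : ℝ} (ha : 0 ≤ a) (ha1 : a ≤ 1)
    (s : Vec m) (ρ : ℝ) :
    gaussLaw q m {w | ‖s - w‖ ^ 2 ≤ ρ} ≤ gaussLaw q m {w | ‖a • s - w‖ ^ 2 ≤ ρ} := by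
  set B' := {w : Vec m | ‖s - w‖ ^ 2 ≤ ρ} with hB'
  set B := {w : Vec m | ‖a • s - w‖ ^ 2 ≤ ρ} with hB
  have mB' : MeasurableSet B' := measurableSet_norm_sub_sq_le _ _
  have mB : MeasurableSet B := measurableSet_norm_sub_sq_le _ _
  rw [← measure_inter_add_sdiff B' mB, ← measure_inter_add_sdiff B mB', Set.inter_comm B B']
  refine add_le_add_right ?_ _
  have hmp := Measure.measurePreserving_sub_left (volume : Measure (Vec m)) (s + a • s)
  have hpre : (fun w => s + a • s - w) ⁻¹' (B \ B') = B' \ B := by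
    ext w
    have h1 : a • s - (s + a • s - w) = -(s - w) := by abel
    have h2 : s - (s + a • s - w) = -(a • s - w) := by abel
    simp only [hB, hB', Set.mem_preimage, Set.mem_sdiff, Set.mem_ofPred_eq, h1, h2, norm_neg]
  rw [gaussLaw_eq_withDensity hq, withDensity_apply _ (mB'.diff mB),
    withDensity_apply _ (mB.diff mB'),
    ← hmp.setLIntegral_comp_preimage (mB.diff mB') (measurable_gaussDensity_norm q), hpre]
  refine setLIntegral_mono' (mB'.diff mB) fun w hw => ENNReal.ofReal_le_ofReal ?_
  have h1 : ‖s - w‖ ^ 2 ≤ ρ := hw.1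
  have h2 : ρ < ‖a • s - w‖ ^ 2 := not_le.1 hw.2
  have h3 := norm_smul_sub_sq 1 s w
  rw [one_smul] at h3
  have h4 := norm_smul_sub_sq (1 + a) s w
  rw [add_smul, one_smul] at h4
  rw [norm_smul_sub_sq] at h2
  have h5 : (1 - a) * ((1 + a) * ‖s‖ ^ 2 - 2 * inner ℝ s w) < 0 := by nlinarith
  have h6 : (1 + a) * ‖s‖ ^ 2 - 2 * inner ℝ s w ≤ 0 := by
    by_contra h
    exact absurd h5 (not_lt.2 (mul_nonneg (by linarith) (not_le.1 h).le))
  have h7 : ‖s + a • s - w‖ ^ 2 ≤ ‖w‖ ^ 2 := by rw [h4]; nlinarith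
  unfold gaussDensity
  gcongr

lemma uniformSphere_norm_ne {r : ℝ} (hr : 0 ≤ r) (m : ℕ) :
    uniformSphere r m {w | ‖w‖ ≠ r} = 0 := by
  have hmeas : Measurable fun x : Metric.sphere (0 : Vec m) 1 => r • (x : Vec m) := by fun_prop
  rw [uniformSphere, Measure.map_apply hmeas
    (show MeasurableSet {w : Vec m | ‖w‖ ≠ r} from
      (measurableSet_eq_fun measurable_norm measurable_const).compl)]
  convert measure_empty
  · ext x
    simp [norm_smul, abs_of_nonneg hr]
  · infer_instance

/-- On the sphere, closeness to `s` is the linear condition `2 ⟪s, w⟫ ≥ ‖s‖² + r² - ρ`. Multiplied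
by `a` it implies the condition for `a • s`, because `r² - ρ ≤ a² ‖s‖² ≤ a ‖s‖²`. Some lower bound
on the norm is needed: a ball around a very short vector may miss the sphere. -/
lemma uniformSphere_ball_smul_le {r : ℝ} (hr : 0 ≤ r) {m : ℕ} {a : ℝ} (ha : 0 ≤ a) (ha1 : a ≤ 1)
    (s : Vec m) {ρ : ℝ} (h : r ^ 2 - ρ ≤ ‖a • s‖ ^ 2) :
    uniformSphere r m {w | ‖s - w‖ ^ 2 ≤ ρ} ≤ uniformSphere r m {w | ‖a • s - w‖ ^ 2 ≤ ρ} := by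
  refine measure_mono_ae ?_
  have hae : ∀ᵐ w ∂uniformSphere r m, ‖w‖ = r := by
    simpa [ae_iff] using uniformSphere_norm_ne hr m
  filter_upwards [hae] with w hw h1
  have h1 : ‖s - w‖ ^ 2 ≤ ρ := h1
  change ‖a • s - w‖ ^ 2 ≤ ρ
  have h3 := norm_smul_sub_sq 1 s w
  rw [one_smul, hw] at h3
  rw [norm_smul_sub_sq, hw]
  rw [norm_smul, mul_pow, Real.norm_eq_abs, sq_abs] at h
  nlinarith [mul_le_mul_of_nonneg_left ha1 (mul_nonneg ha (sq_nonneg ‖s‖))]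

/-- The sub-codebook sizes are computed at the upper end of a power type class. Monotonicity in the
norm makes that choice sufficient for every sequence of the class. -/
lemma codewordLaw_ball_antitone (c : Codebook) {q : ℝ} (hq : 0 < q) {m : ℕ} (hm : 0 < m)
    {s t : Vec m} (hst : ‖s‖ ≤ ‖t‖) {ρ : ℝ} (h : m * q - ρ ≤ ‖s‖ ^ 2) :
    codewordLaw c q m {w | ‖t - w‖ ^ 2 ≤ ρ} ≤ codewordLaw c q m {w | ‖s - w‖ ^ 2 ≤ ρ} := by
  rcases (norm_nonneg t).eq_or_lt with ht | ht
  · exact (codewordLaw_ball_congr c hq hm (by linarith [norm_nonneg s]) ρ).le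
  set a := ‖s‖ / ‖t‖ with ha
  have ha0 : 0 ≤ a := by positivity
  have ha1 : a ≤ 1 := div_le_one_of_le₀ hst ht.le
  have hs : ‖s‖ = ‖a • t‖ := by
    rw [norm_smul, Real.norm_of_nonneg ha0, ha, div_mul_cancel₀ _ ht.ne']
  rw [codewordLaw_ball_congr c hq hm hs ρ]
  cases c with
  | iid => exact gaussLaw_ball_smul_le hq ha0 ha1 t ρ
  | sp =>
    refine uniformSphere_ball_smul_le (Real.sqrt_nonneg _) ha0 ha1 t ?_
    rwa [Real.sq_sqrt (by positivity), ← hs]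

/-! ### Concentration -/

/-- Chebyshev's inequality. The summands may depend on the coordinate, so that both `‖x‖²` and inner
products with a fixed vector are covered. -/
lemma iidLaw_sum_concentration (μ : Measure ℝ) [IsProbabilityMeasure μ] {m : ℕ}
    {f : Fin m → ℝ → ℝ} (hfm : ∀ i, Measurable (f i)) (hf : ∀ i, MemLp (f i) 2 μ)
    {t : ℝ} (ht : 0 < t) :
    (iidLaw μ m).real {x | t ≤ |∑ i, f i (x i) - ∑ i, ∫ a, f i a ∂μ|} ≤
      (∑ i, Var[f i; μ]) / t ^ 2 := by
  have hmeas : MeasurableSet {x : Vec m | t ≤ |∑ i, f i (x i) - ∑ i, ∫ a, f i a ∂μ|} :=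
    measurableSet_le measurable_const (by fun_prop)
  have hmem : ∀ i, MemLp (fun x : Fin m → ℝ => f i (x i)) 2 (Measure.pi fun _ : Fin m => μ) :=
    fun i => (hf i).comp_measurePreserving (measurePreserving_eval (fun _ : Fin m => μ) i)
  have hint : ∫ x : Fin m → ℝ, (∑ i, fun x : Fin m → ℝ => f i (x i)) x
      ∂(Measure.pi fun _ : Fin m => μ) = ∑ i, ∫ a, f i a ∂μ := by
    simp only [Finset.sum_apply]
    rw [integral_finsetSum _ fun i _ => (hmem i).integrable one_le_two]
    refine Finset.sum_congr rfl fun i _ => ?_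
    exact integral_comp_eval (μ := fun _ : Fin m => μ) (hf i).aestronglyMeasurable
  have h := meas_ge_le_variance_div_sq (memLp_finsetSum' Finset.univ fun i _ => hmem i) ht
  rw [variance_sum_pi (μ := fun _ : Fin m => μ) hf, hint] at h
  rw [measureReal_def, iidLaw, Measure.map_apply (by fun_prop) hmeas]
  refine ENNReal.toReal_le_of_le_ofReal
    (div_nonneg (Finset.sum_nonneg fun i _ => variance_nonneg _ _) (sq_nonneg _)) ?_
  refine le_trans (le_of_eq ?_) h
  congr 1
  ext x
  simp

lemma iidLaw_norm_sq_concentration (μ : Measure ℝ) [IsProbabilityMeasure μ]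
    (hμ : MemLp (fun x : ℝ => x ^ 2) 2 μ) (m : ℕ) {t : ℝ} (ht : 0 < t) :
    (iidLaw μ m).real {x | t ≤ |‖x‖ ^ 2 - m * ∫ a, a ^ 2 ∂μ|} ≤
      m * Var[fun x : ℝ => x ^ 2; μ] / t ^ 2 := by
  have h := iidLaw_sum_concentration μ (m := m) (f := fun _ x => x ^ 2)
    (fun _ => by fun_prop) (fun _ => hμ) ht
  simpa [EuclideanSpace.norm_sq_eq] using h

lemma gaussLaw_inner_concentration {q : ℝ} (hq : 0 < q) {m : ℕ} (y : Vec m) {t : ℝ} (ht : 0 < t) :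
    (gaussLaw q m).real {x | t ≤ |inner ℝ y x|} ≤ q * ‖y‖ ^ 2 / t ^ 2 := by
  have h := iidLaw_sum_concentration (gaussianReal 0 q.toNNReal) (m := m)
    (f := fun i x => y i * x) (fun i => by fun_prop)
    (fun i => (memLp_id_gaussianReal' 2 (by simp)).const_mul (y i)) ht
  have hv : ∀ i, Var[fun x => y i * x; gaussianReal 0 q.toNNReal] = y i ^ 2 * q := by
    intro i
    rw [variance_const_mul, variance_fun_id_gaussianReal, Real.coe_toNNReal _ hq.le]
  have h0 : ∑ i, ∫ x, y i * x ∂gaussianReal 0 q.toNNReal = 0 :=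
    Finset.sum_eq_zero fun i _ => by
      rw [integral_const_mul, integral_id_gaussianReal, mul_zero]
  simp only [h0, sub_zero, hv, ← Finset.sum_mul] at h
  rw [EuclideanSpace.norm_sq_eq, mul_comm q]
  simpa [PiLp.inner_apply, mul_comm] using h

lemma memLp_sq_gaussianReal (v : NNReal) :
    MemLp (fun x : ℝ => x ^ 2) 2 (gaussianReal 0 v) := by
  refine (memLp_two_iff_integrable_sq (by fun_prop)).2 ?_
  have h := (memLp_id_gaussianReal (μ := 0) (v := v) 4).integrable_norm_pow (by norm_num)
  refine h.congr (ae_of_all _ fun x => ?_)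
  simp [← pow_mul, Even.pow_abs (show Even 4 by decide)]

lemma integral_sq_gaussianReal (v : NNReal) : ∫ x, x ^ 2 ∂gaussianReal 0 v = v := by
  have h := variance_fun_id_gaussianReal (μ := 0) (v := v)
  rw [variance_of_integral_eq_zero (by fun_prop) (by simp)] at h
  simpa using h

lemma eventually_iidLaw_norm_sq (μ : Measure ℝ) [IsProbabilityMeasure μ]
    (hμ : MemLp (fun x : ℝ => x ^ 2) 2 μ) {ζ ε : ℝ} (hζ : 0 < ζ) (hε : 0 < ε) :
    ∀ᶠ m : ℕ in atTop,
      (iidLaw μ m).real {x | ¬ |‖x‖ ^ 2 - m * ∫ a, a ^ 2 ∂μ| ≤ m * ζ} ≤ ε := by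
  have hlim : Tendsto (fun m : ℕ => Var[fun x : ℝ => x ^ 2; μ] / ζ ^ 2 / m) atTop (𝓝 0) :=
    tendsto_const_div_atTop_nhds_zero_nat _
  filter_upwards [hlim.eventually (ge_mem_nhds hε), eventually_gt_atTop 0] with m hm hm0
  have hm0' : (0 : ℝ) < m := by exact_mod_cast hm0
  refine le_trans (measureReal_mono fun x hx => ?_) <|
    (iidLaw_norm_sq_concentration μ hμ m (mul_pos hm0' hζ)).trans (le_trans (le_of_eq ?_) hm)
  · exact (not_le.1 hx).le
  · field_simp

/-- The threshold on `m` is uniform in `y`, because the Chebyshev bound for the inner product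
involves `y` only through its norm. -/
lemma eventually_gaussLaw_typical {q : ℝ} (hq : 0 < q) {ζ ε B : ℝ} (hζ : 0 < ζ) (hε : 0 < ε) :
    ∀ᶠ m : ℕ in atTop, ∀ y : Vec m, ‖y‖ ^ 2 ≤ m * B →
      (gaussLaw q m).real {g | ¬ (|‖g‖ ^ 2 - m * q| ≤ m * ζ ∧ |inner ℝ y g| ≤ m * ζ)} ≤ ε := by
  have hlim : Tendsto (fun m : ℕ => q * B / ζ ^ 2 / m) atTop (𝓝 0) :=
    tendsto_const_div_atTop_nhds_zero_nat _
  filter_upwards [eventually_iidLaw_norm_sq (gaussianReal 0 q.toNNReal)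
    (memLp_sq_gaussianReal _) hζ (half_pos hε), hlim.eventually (ge_mem_nhds (half_pos hε)),
    eventually_gt_atTop 0] with m h1 h2 hm0 y hy
  rw [integral_sq_gaussianReal, Real.coe_toNNReal _ hq.le] at h1
  have hm0' : (0 : ℝ) < m := by exact_mod_cast hm0
  have h3 : (gaussLaw q m).real {g | m * ζ ≤ |inner ℝ y g|} ≤ ε / 2 := by
    refine (gaussLaw_inner_concentration hq y (mul_pos hm0' hζ)).trans (le_trans ?_ h2)
    rw [div_div, div_le_div_iff₀ (by positivity) (by positivity)]
    calc q * ‖y‖ ^ 2 * (ζ ^ 2 * m) ≤ q * (m * B) * (ζ ^ 2 * m) := by gcongr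
      _ = _ := by ring
  calc _ ≤ (gaussLaw q m).real ({g | ¬ |‖g‖ ^ 2 - m * q| ≤ m * ζ} ∪
        {g | m * ζ ≤ |inner ℝ y g|}) := by
        refine measureReal_mono fun g hg => ?_
        rcases not_and_or.1 hg with h | h
        · exact Or.inl h
        · exact Or.inr (not_le.1 h).le
    _ ≤ _ := measureReal_union_le _ _
    _ ≤ ε / 2 + ε / 2 := add_le_add h1 h3
    _ = ε := by ring

lemma eventually_codewordLaw_typical (c : Codebook) {q : ℝ} (hq : 0 < q) {ζ ε B : ℝ}
    (hζ : 0 < ζ) (hε : 0 < ε) :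
    ∀ᶠ m : ℕ in atTop, ∀ y : Vec m, ‖y‖ ^ 2 ≤ m * B →
      (codewordLaw c q m).real
        {x | ¬ (|‖x‖ ^ 2 - m * q| ≤ m * ζ ∧ |inner ℝ y x| ≤ m * ζ)} ≤ ε := by
  cases c with
  | iid => exact eventually_gaussLaw_typical hq hζ hε
  | sp =>
    -- The second bound forces `‖w‖² ≥ m q / 4`, so normalizing multiplies `w` by at most `2`; the
    -- first bound absorbs that factor in the inner product.
    have hζ' : 0 < min (ζ / 2) (3 / 4 * q) := by positivity
    filter_upwards [eventually_gaussLaw_typical hq (B := B) hζ' hε, eventually_gt_atTop 0]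
      with m h hm y hy
    have hm' : (0 : ℝ) < m := by exact_mod_cast hm
    have hmeas : MeasurableSet
        {x : Vec m | ¬ (|‖x‖ ^ 2 - m * q| ≤ m * ζ ∧ |inner ℝ y x| ≤ m * ζ)} :=
      ((measurableSet_le (f := fun x : Vec m => |‖x‖ ^ 2 - m * q|) (by fun_prop)
        measurable_const).inter (measurableSet_le (f := fun x : Vec m => |inner ℝ y x|)
        (by fun_prop) measurable_const)).compl
    refine le_trans ?_ (h y hy)
    rw [measureReal_def, codewordLaw, uniformSphere_apply hq hm _ hmeas, ← measureReal_def]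
    refine measureReal_mono fun w hw hw' => hw ?_
    obtain ⟨h1, h2⟩ := hw'
    have h3 : m * min (ζ / 2) (3 / 4 * q) ≤ m * (3 / 4 * q) := by gcongr; exact min_le_right _ _
    have h4 : m * min (ζ / 2) (3 / 4 * q) ≤ m * (ζ / 2) := by gcongr; exact min_le_left _ _
    have h5 : m * q / 4 ≤ ‖w‖ ^ 2 := by linarith [(abs_le.1 h1).1]
    have hmq : 0 < m * q := by positivity
    have hw0 : 0 < ‖w‖ := by
      by_contra h0
      have : ‖w‖ = 0 := le_antisymm (not_lt.1 h0) (norm_nonneg _)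
      rw [this] at h5
      nlinarith
    have hr : Real.sqrt (m * q) / ‖w‖ ≤ 2 := by
      rw [div_le_iff₀ hw0]
      refine Real.sqrt_le_iff.2 ⟨by positivity, by nlinarith⟩
    have hr0 : 0 ≤ Real.sqrt (m * q) / ‖w‖ := by positivity
    have hn : ‖(Real.sqrt (m * q) / ‖w‖) • w‖ = Real.sqrt (m * q) := by
      rw [norm_smul, Real.norm_of_nonneg hr0, div_mul_cancel₀ _ hw0.ne']
    change |‖(Real.sqrt (m * q) / ‖w‖) • w‖ ^ 2 - m * q| ≤ m * ζ ∧
      |inner ℝ y ((Real.sqrt (m * q) / ‖w‖) • w)| ≤ m * ζ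
    rw [hn, Real.sq_sqrt hmq.le, sub_self, abs_zero, inner_smul_right, abs_mul, abs_of_nonneg hr0]
    refine ⟨by positivity, ?_⟩
    calc Real.sqrt (m * q) / ‖w‖ * |inner ℝ y w| ≤ 2 * (m * (ζ / 2)) := by
          gcongr
          exact h2.trans h4
      _ = m * ζ := by ring

/-! ### The probability that a codeword falls into a ball -/

lemma norm_sub_smul_normalize_le {m : ℕ} {r : ℝ} (w : Vec m) :
    ‖w - (r / ‖w‖) • w‖ ≤ |‖w‖ - r| := by
  rcases eq_or_ne w 0 with rfl | hw
  · simp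
  have hw' : 0 < ‖w‖ := norm_pos_iff.2 hw
  have h : w - (r / ‖w‖) • w = (1 - r / ‖w‖) • w := by rw [sub_smul, one_smul]
  have h2 : 1 - r / ‖w‖ = (‖w‖ - r) / ‖w‖ := by field_simp
  rw [h, norm_smul, h2, Real.norm_eq_abs, abs_div, abs_of_pos hw', div_mul_cancel₀ _ hw'.ne']

lemma abs_sub_sqrt_le {q t ζ : ℝ} (hq : 0 < q) (ht : 0 ≤ t) {m : ℕ} (hm : 0 < m)
    (h : |t ^ 2 - m * q| ≤ m * ζ) : |t - Real.sqrt (m * q)| ≤ Real.sqrt m * (ζ / Real.sqrt q) := by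
  have hm' : (0 : ℝ) < m := by exact_mod_cast hm
  have hr : 0 < Real.sqrt (m * q) := by positivity
  have h1 : |t - Real.sqrt (m * q)| * Real.sqrt (m * q) ≤ m * ζ := by
    refine le_trans ?_ h
    have h2 : t ^ 2 - m * q = (t - Real.sqrt (m * q)) * (t + Real.sqrt (m * q)) := by
      nlinarith [Real.sq_sqrt (show 0 ≤ m * q by positivity)]
    rw [h2, abs_mul, abs_of_nonneg (show 0 ≤ t + Real.sqrt (m * q) by positivity)]
    gcongr
    linarith
  rw [← le_div_iff₀ hr] at h1
  refine h1.trans (le_of_eq ?_)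
  rw [Real.sqrt_mul hm'.le]
  field_simp
  rw [Real.sq_sqrt hm'.le]
  ring

/-- A normalized vector is close to the original one if the norm is nearly right. -/
lemma norm_sub_normalize_le {q ζ : ℝ} (hq : 0 < q) {m : ℕ} (hm : 0 < m) {w : Vec m}
    (h : |‖w‖ ^ 2 - m * q| ≤ m * ζ) :
    ‖w - (Real.sqrt (m * q) / ‖w‖) • w‖ ≤ Real.sqrt m * (ζ / Real.sqrt q) :=
  (norm_sub_smul_normalize_le w).trans (abs_sub_sqrt_le hq (norm_nonneg w) hm h)

/-- Enlarging the radius of a ball by a small multiple of `√m`. -/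
lemma norm_sq_le_of_norm_sub_le {m : ℕ} {y w x : Vec m} {a b c : ℝ}
    (h1 : ‖y - w‖ ^ 2 ≤ m * a) (h2 : ‖w - x‖ ≤ Real.sqrt m * c)
    (h3 : (Real.sqrt a + c) ^ 2 ≤ b) : ‖y - x‖ ^ 2 ≤ m * b := by
  have h4 : ‖y - w‖ ≤ Real.sqrt m * Real.sqrt a := by
    rw [← Real.sqrt_mul (Nat.cast_nonneg m)]
    exact Real.le_sqrt_of_sq_le h1
  have h5 : ‖y - x‖ ≤ Real.sqrt m * (Real.sqrt a + c) := by
    calc ‖y - x‖ ≤ ‖y - w‖ + ‖w - x‖ := norm_sub_le_norm_sub_add_norm_sub _ _ _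
      _ ≤ _ := by linarith
  calc ‖y - x‖ ^ 2 ≤ (Real.sqrt m * (Real.sqrt a + c)) ^ 2 := by gcongr
    _ = m * (Real.sqrt a + c) ^ 2 := by rw [mul_pow, Real.sq_sqrt (Nat.cast_nonneg m)]
    _ ≤ m * b := by gcongr

lemma sqrt_pow_eq_exp {x : ℝ} (hx : 0 < x) (m : ℕ) :
    Real.sqrt x ^ m = Real.exp (m * (Real.log x / 2)) := by
  rw [← Real.log_sqrt hx.le, Real.exp_nat_mul, Real.exp_log (Real.sqrt_pos.2 hx)]

/-- Completing the square as for the posterior law of `w` given `y = w + noise`, with noise of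
variance `D`: the posterior has mean `(q / v) • y` and variance `τ = q D / v`. On the ball the
density is at most `exp K` times the normalizing ratio times this reference density, whose mass is
at most one. The ratio `√(D / v) ^ m` is the exponential of minus `m` times the rate. -/
lemma gaussLaw_ball_le {q D η : ℝ} (hq : 0 < q) (hD : 0 < D) {m : ℕ} (y : Vec m)
    (hy : m * (q + D) - m * η ≤ ‖y‖ ^ 2) :
    (gaussLaw q m).real {w | ‖y - w‖ ^ 2 ≤ m * (D + η)} ≤
      Real.exp (-(m * (Real.log ((q + D) / D) / 2 - (η / (2 * D) + η / (2 * (q + D)))))) := by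
  set v := q + D with hv
  have hv0 : 0 < v := by positivity
  set τ := q * D / v with hτ
  have hτ0 : 0 < τ := by positivity
  set K := m * (D + η) / (2 * D) - (m * v - m * η) / (2 * v) with hK
  have h := gaussLaw_le_of_density_le (K := K) hq hτ0 ((q / v) • y)
    (measurableSet_norm_sub_sq_le y (m * (D + η))) (fun w hw => by
      have hw : ‖y - w‖ ^ 2 ≤ m * (D + η) := hw
      have h1 : -‖w‖ ^ 2 / (2 * q) = ‖y - w‖ ^ 2 / (2 * D) - ‖y‖ ^ 2 / (2 * v) -
          ‖w - (q / v) • y‖ ^ 2 / (2 * τ) := by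
        rw [norm_sub_rev w, norm_smul_sub_sq, norm_sub_sq_real, hτ, hv]
        field_simp
        ring
      rw [h1, hK]
      gcongr)
  refine h.trans ?_
  have h2 : Real.sqrt (τ / q) ^ m * Real.exp K = Real.exp (-(m * (Real.log (v / D) / 2 -
      (η / (2 * D) + η / (2 * v))))) := by
    have h3 : τ / q = (v / D)⁻¹ := by rw [hτ]; field_simp
    rw [sqrt_pow_eq_exp (by positivity), ← Real.exp_add, h3, Real.log_inv, hK]
    congr 1
    field_simp
    ring
  rw [h2]
  exact mul_le_of_le_one_right (Real.exp_pos _).le measureReal_le_one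

lemma eventually_gaussLaw_ball_le {q D δ : ℝ} (hq : 0 < q) (hD : 0 < D) (hδ : 0 < δ) :
    ∃ η > 0, ∀ m : ℕ, ∀ y : Vec m, |‖y‖ ^ 2 - m * (q + D)| ≤ m * η →
      (gaussLaw q m).real {w | ‖y - w‖ ^ 2 ≤ m * (D + η)} ≤
        Real.exp (-(m * (Real.log ((q + D) / D) / 2 - δ))) := by
  refine ⟨δ / (1 / (2 * D) + 1 / (2 * (q + D))), by positivity, fun m y hy => ?_⟩
  refine (gaussLaw_ball_le hq hD y (by linarith [(abs_le.1 hy).1])).trans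
    (Real.exp_le_exp.2 (le_of_eq ?_))
  field_simp

lemma measurableSet_norm_sq_close (m : ℕ) (a b : ℝ) :
    MeasurableSet {t : ℝ | |t ^ 2 - m * a| ≤ b} :=
  measurableSet_le (by fun_prop) measurable_const

/-- A random codeword is close to a vector `y` of power `q + D` with probability at most about
`exp (- m R(q + D, D))`. -/
lemma eventually_codewordLaw_ball_le (c : Codebook) {q D δ : ℝ} (hq : 0 < q) (hD : 0 < D)
    (hδ : 0 < δ) :
    ∃ η > 0, ∀ᶠ m : ℕ in atTop, ∀ y : Vec m, |‖y‖ ^ 2 - m * (q + D)| ≤ m * η →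
      (codewordLaw c q m).real {w | ‖y - w‖ ^ 2 ≤ m * (D + η)} ≤
        Real.exp (-(m * (Real.log ((q + D) / D) / 2 - δ))) := by
  obtain ⟨η₂, hη₂, hg⟩ := eventually_gaussLaw_ball_le hq hD (half_pos hδ)
  cases c with
  | iid =>
    refine ⟨η₂, hη₂, Eventually.of_forall fun m y hy => (hg m y hy).trans ?_⟩
    gcongr
    linarith
  | sp =>
    -- The radius is enlarged by the error of the normalization; for small `t` the result still lies
    -- below `D + η₂`.
    have hcont : Tendsto (fun t : ℝ => (Real.sqrt (D + t) + t / Real.sqrt q) ^ 2) (𝓝[>] 0)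
        (𝓝 ((Real.sqrt (D + 0) + 0 / Real.sqrt q) ^ 2)) :=
      (Continuous.tendsto (by fun_prop) 0).mono_left nhdsWithin_le_nhds
    have h0 : (Real.sqrt (D + 0) + 0 / Real.sqrt q) ^ 2 < D + η₂ := by
      rw [add_zero, zero_div, add_zero, Real.sq_sqrt hD.le]; linarith
    obtain ⟨η, ⟨h1, h2⟩, hη⟩ := ((hcont.eventually (gt_mem_nhds h0)).and
      (nhdsWithin_le_nhds (ge_mem_nhds hη₂))).and self_mem_nhdsWithin |>.exists
    have hη : 0 < η := hη
    refine ⟨η, hη, ?_⟩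
    filter_upwards [eventually_gaussLaw_typical hq (B := 0) hη one_half_pos,
      eventually_gt_atTop 0, eventually_ge_atTop ⌈2 * Real.log 2 / δ⌉₊] with m hm hm0 hm1 y hy
    have hm0' : (0 : ℝ) < m := by exact_mod_cast hm0
    set A := {w : Vec m | ‖y - w‖ ^ 2 ≤ m * (D + η)} with hA
    set I := {t : ℝ | |t ^ 2 - m * q| ≤ m * η} with hI
    -- Independence of norm and direction turns the spherical probability times `P(norm typical) ≥
    -- 1/2` into a Gaussian probability, so passing to the sphere costs only a factor `2`.
    have hpolar := congrArg ENNReal.toReal (gaussLaw_polar hq hm0 (Real.sqrt (m * q))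
      (measurableSet_norm_sub_sq_le y (m * (D + η))) (measurableSet_norm_sq_close m q (m * η)))
    rw [ENNReal.toReal_mul] at hpolar
    have hI2 : 1 / 2 ≤ (gaussLaw q m).real {w | ‖w‖ ∈ I} := by
      have h3 := hm 0 (by simp)
      have h4 : {g : Vec m | ¬ (|‖g‖ ^ 2 - m * q| ≤ m * η ∧ |inner ℝ (0 : Vec m) g| ≤ m * η)} =
          {w : Vec m | ‖w‖ ∈ I}ᶜ := by
        ext g
        simp [hI, (mul_pos hm0' hη).le]
      rw [h4, probReal_compl_eq_one_sub (show MeasurableSet {w : Vec m | ‖w‖ ∈ I} from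
        measurable_norm (measurableSet_norm_sq_close m q (m * η)))] at h3
      linarith
    have hle : (gaussLaw q m).real {w | (Real.sqrt (m * q) / ‖w‖) • w ∈ A ∧ ‖w‖ ∈ I} ≤
        (gaussLaw q m).real {w | ‖y - w‖ ^ 2 ≤ m * (D + η₂)} := by
      refine measureReal_mono fun w hw => ?_
      exact norm_sq_le_of_norm_sub_le hw.1
        (by rw [norm_sub_rev]; exact norm_sub_normalize_le hq hm0 hw.2) h1.le
    have hfin := hle.trans (hg m y (hy.trans (by gcongr)))
    rw [measureReal_def, hpolar, ← measureReal_def, ← measureReal_def] at hfin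
    have h5 : (uniformSphere (Real.sqrt (m * q)) m).real A ≤
        2 * Real.exp (-(m * (Real.log ((q + D) / D) / 2 - δ / 2))) := by
      have h6 : 0 ≤ (uniformSphere (Real.sqrt (m * q)) m).real A := measureReal_nonneg
      nlinarith
    refine h5.trans ?_
    -- For these `m` the factor `2` is absorbed by `exp (m δ / 2)`.
    have h7 : 2 * Real.log 2 / δ ≤ m := Nat.ceil_le.1 hm1
    rw [div_le_iff₀ hδ] at h7
    rw [← Real.exp_log (zero_lt_two' ℝ), ← Real.exp_add, Real.exp_log (zero_lt_two' ℝ)]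
    refine Real.exp_le_exp.2 ?_
    linarith

-- Change of measure to a Gaussian law with centre `a • y` and variance `τ = q - a² v`. This keeps
-- the power of `w` near `q`, and its typical squared distance from `y` is `m ((1 - a)² v + τ) = m
-- (D - 2 α v)` for `a = q / v + α`. So taking `a` slightly larger than the posterior value `q / v`
-- puts typical points strictly inside the ball, at a small cost in the exponent. The control of
-- `‖w‖` is kept for the passage to the sphere.
set_option maxHeartbeats 1000000 in
lemma eventually_le_gaussLaw_ball {q D δ : ℝ} (hq : 0 < q) (hD : 0 < D) (hδ : 0 < δ) :
    ∃ θ > 0, θ < D ∧ ∀ η' > 0, ∃ η > 0, ∀ᶠ m : ℕ in atTop, ∀ y : Vec m,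
      |‖y‖ ^ 2 - m * (q + D)| ≤ m * η →
      Real.exp (-(m * (Real.log ((q + D) / D) / 2 + δ))) ≤
        (gaussLaw q m).real
          {w | ‖y - w‖ ^ 2 ≤ m * (D - θ) ∧ |‖w‖ ^ 2 - m * q| ≤ m * η'} := by
  set v := q + D with hv
  have hv0 : 0 < v := by positivity
  set T : ℝ → ℝ := fun α => q - (q / v + α) ^ 2 * v with hT
  have hT0 : T 0 = q * D / v := by simp only [hT, hv]; field_simp; ring
  have hTc : Continuous T := by simp only [hT]; fun_prop
  have hT0' : 0 < T 0 := by rw [hT0]; positivity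
  have e1 : ∀ᶠ α in 𝓝[>] (0 : ℝ), 0 < T α :=
    nhdsWithin_le_nhds (hTc.tendsto 0 |>.eventually (lt_mem_nhds hT0'))
  have e2 : ∀ᶠ α in 𝓝[>] (0 : ℝ), -(Real.log (v / D)) - δ < Real.log (T α / q) := by
    have hc : Tendsto (fun α => Real.log (T α / q)) (𝓝 0) (𝓝 (Real.log (T 0 / q))) :=
      ((hTc.tendsto 0).div_const q).log (by positivity)
    refine nhdsWithin_le_nhds (hc.eventually (lt_mem_nhds ?_))
    have h3 : T 0 / q = (v / D)⁻¹ := by rw [hT0]; field_simp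
    rw [h3, Real.log_inv]
    linarith
  have e3 : ∀ᶠ α in 𝓝[>] (0 : ℝ), α * v < D := by
    have hc : Tendsto (fun α : ℝ => α * v) (𝓝 0) (𝓝 (0 * v)) :=
      Continuous.tendsto (by fun_prop) 0
    exact nhdsWithin_le_nhds (hc.eventually (gt_mem_nhds (by simpa using hD)))
  have e4 : ∀ᶠ α in 𝓝[>] (0 : ℝ), q / v + α < 1 := by
    have hc : Tendsto (fun α : ℝ => q / v + α) (𝓝 0) (𝓝 (q / v + 0)) :=
      Continuous.tendsto (by fun_prop) 0
    refine nhdsWithin_le_nhds (hc.eventually (gt_mem_nhds ?_))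
    rw [add_zero, div_lt_one hv0]
    linarith
  obtain ⟨α, ⟨⟨⟨h1, h2⟩, h3⟩, h4⟩, hα⟩ :=
    (((e1.and e2).and e3).and e4).and self_mem_nhdsWithin |>.exists
  have hα : 0 < α := hα
  set a := q / v + α with ha
  set τ := T α with hτ
  have hτ' : τ = q - a ^ 2 * v := rfl
  have ha0 : 0 < a := by positivity
  have hav : a * v = q + α * v := by rw [ha, add_mul, div_mul_cancel₀ _ hv0.ne']
  refine ⟨α * v, by positivity, h3, fun η' hη' => ?_⟩
  -- `κ ζ` is the loss per coordinate in the exponent when norms are known up to `4 ζ` and `ζ`. The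
  -- three bounds on `ζ` keep typical points in the ball of squared radius `m (D - α v)`, keep the
  -- norm within `η'`, and keep the loss below `δ / 4`.
  set κ := 4 / (2 * q) + 1 / (2 * τ) with hκ
  have hκ0 : 0 < κ := by positivity
  set ζ := min (min (α * v / 4) (η' / 4)) (δ / (4 * κ)) with hζ
  have hζ0 : 0 < ζ := by positivity
  have hζ1 : 4 * ζ ≤ α * v := by
    have := (min_le_left _ _).trans (min_le_left _ _) |> hζ.le.trans
    linarith
  have hζ2 : 4 * ζ ≤ η' := by
    have := (min_le_left _ _).trans (min_le_right _ _) |> hζ.le.trans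
    linarith
  have hζ3 : κ * ζ ≤ δ / 4 := by
    have h5 := hζ.le.trans (min_le_right _ _)
    rw [le_div_iff₀ (by positivity)] at h5
    linarith
  refine ⟨ζ, hζ0, ?_⟩
  filter_upwards [eventually_gaussLaw_typical h1 (B := v + ζ) hζ0 one_half_pos,
    eventually_ge_atTop ⌈4 * Real.log 2 / δ⌉₊] with m hm hm1 y hy
  have hm0 : (0 : ℝ) ≤ m := Nat.cast_nonneg m
  obtain ⟨hy1, hy2⟩ := abs_le.1 hy
  set A := {w : Vec m | ‖y - w‖ ^ 2 ≤ m * (D - α * v) ∧ |‖w‖ ^ 2 - m * q| ≤ m * η'} with hA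
  set G := {w : Vec m | |‖w - a • y‖ ^ 2 - m * τ| ≤ m * ζ ∧ |inner ℝ y (w - a • y)| ≤ m * ζ}
    with hG
  have hGm : MeasurableSet G :=
    (measurableSet_le (f := fun w : Vec m => |‖w - a • y‖ ^ 2 - m * τ|) (by fun_prop)
      measurable_const).inter (measurableSet_le (f := fun w : Vec m => |inner ℝ y (w - a • y)|)
        (by fun_prop) measurable_const)
  have hnorm : ∀ w ∈ G, |‖w‖ ^ 2 - m * q| ≤ m * (4 * ζ) ∧ ‖y - w‖ ^ 2 ≤ m * (D - α * v) := by
    rintro w ⟨hw1, hw2⟩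
    set g := w - a • y with hg
    obtain ⟨hw1, hw1'⟩ := abs_le.1 hw1
    obtain ⟨hw2, hw2'⟩ := abs_le.1 hw2
    have hw : ‖w‖ ^ 2 = a ^ 2 * ‖y‖ ^ 2 + 2 * a * inner ℝ y g + ‖g‖ ^ 2 := by
      have h := norm_smul_sub_sq a y (-g)
      rw [inner_neg_right, norm_neg, sub_neg_eq_add, hg, add_sub_cancel] at h
      rw [h]; ring
    have hyw : ‖y - w‖ ^ 2 = (1 - a) ^ 2 * ‖y‖ ^ 2 - 2 * (1 - a) * inner ℝ y g + ‖g‖ ^ 2 := by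
      rw [← norm_smul_sub_sq, sub_smul, one_smul, hg]
      congr 2
      abel
    have ha2 : a ^ 2 ≤ 1 := by nlinarith
    have ha3 : (1 - a) ^ 2 ≤ 1 := by nlinarith
    have hmζ : 0 ≤ m * ζ := by positivity
    have ha4 : 0 ≤ 1 - a := by linarith
    have p1 : |a ^ 2 * (‖y‖ ^ 2 - m * v)| ≤ m * ζ := by
      rw [abs_mul, abs_of_nonneg (sq_nonneg a)]
      exact (mul_le_of_le_one_left (abs_nonneg _) ha2).trans hy
    have p2 : |a * inner ℝ y g| ≤ m * ζ := by
      rw [abs_mul, abs_of_nonneg ha0.le]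
      exact (mul_le_of_le_one_left (abs_nonneg _) h4.le).trans (abs_le.2 ⟨hw2, hw2'⟩)
    have p3 : |(1 - a) ^ 2 * (‖y‖ ^ 2 - m * v)| ≤ m * ζ := by
      rw [abs_mul, abs_of_nonneg (sq_nonneg _)]
      exact (mul_le_of_le_one_left (abs_nonneg _) ha3).trans hy
    have p4 : |(1 - a) * inner ℝ y g| ≤ m * ζ := by
      rw [abs_mul, abs_of_nonneg ha4]
      exact (mul_le_of_le_one_left (abs_nonneg _) (by linarith)).trans (abs_le.2 ⟨hw2, hw2'⟩)
    rw [abs_le] at p1 p2 p3 p4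
    have hmτ : m * τ = m * q - a ^ 2 * (m * v) := by rw [hτ']; ring
    constructor
    · have e : ‖w‖ ^ 2 - m * q = a ^ 2 * (‖y‖ ^ 2 - m * v) + 2 * (a * inner ℝ y g) +
          (‖g‖ ^ 2 - m * τ) := by linear_combination hw + hmτ
      rw [e, abs_le]
      constructor <;> linarith
    · have hmz : m * (4 * ζ) ≤ m * (α * v) := by gcongr
      have hid : (1 - a) ^ 2 * (m * v) + m * τ = m * (D - 2 * (α * v)) := by
        rw [hτ']
        linear_combination (-2 * (m : ℝ)) * hav + m * hv
      have e : ‖y - w‖ ^ 2 = (1 - a) ^ 2 * (‖y‖ ^ 2 - m * v) - 2 * ((1 - a) * inner ℝ y g) +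
          (‖g‖ ^ 2 - m * τ) + m * (D - 2 * (α * v)) := by linear_combination hyw + hid
      rw [e]
      linarith
  -- `G` is the typical set of the reference law, of mass at least `1/2`; the density comparison is
  -- needed only there.
  have hGA : G ⊆ A := fun w hw => ⟨(hnorm w hw).2, (hnorm w hw).1.trans (by gcongr)⟩
  have hprob : 1 / 2 ≤ (gaussLaw τ m).real {g | a • y + g ∈ G} := by
    have h5 := hm y (by linarith)
    have h6 : {g : Vec m | ¬ (|‖g‖ ^ 2 - m * τ| ≤ m * ζ ∧ |inner ℝ y g| ≤ m * ζ)} =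
        {g : Vec m | a • y + g ∈ G}ᶜ := by
      ext g
      simp [hG]
    rw [h6, probReal_compl_eq_one_sub (show MeasurableSet {g : Vec m | a • y + g ∈ G} from
      measurable_const_add (a • y) hGm)] at h5
    linarith
  have hlow := le_gaussLaw_of_le_density (K := -(m * (κ * ζ))) hq h1 (a • y) hGm fun w hw => by
    have hw1 := (abs_le.1 (hnorm w hw).1).2
    have hw2 := (abs_le.1 hw.1).1
    have h7 : -‖w‖ ^ 2 / (2 * q) ≥ -(m * q + m * (4 * ζ)) / (2 * q) := by
      gcongr; linarith
    have h8 : ‖w - a • y‖ ^ 2 / (2 * τ) ≥ (m * τ - m * ζ) / (2 * τ) := by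
      gcongr; linarith
    have h9 : -(m * q + m * (4 * ζ)) / (2 * q) + (m * τ - m * ζ) / (2 * τ) =
        -(m * (κ * ζ)) := by
      rw [hκ]; field_simp; ring
    linarith
  refine le_trans ?_ (hlow.trans (measureReal_mono hGA))
  have h7 : 4 * Real.log 2 / δ ≤ m := Nat.ceil_le.1 hm1
  rw [div_le_iff₀ hδ] at h7
  have h8 : Real.exp (-(m * (δ / 4))) ≤ 1 / 2 := by
    rw [one_div, ← Real.exp_log (zero_lt_two' ℝ), ← Real.exp_neg]
    exact Real.exp_le_exp.2 (by linarith)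
  -- The allowance `δ` is spent as `δ / 2` on `τ` differing from `q D / v`, `δ / 4` on `κ ζ`, and `δ
  -- / 4` on the factor `1/2`.
  calc Real.exp (-(m * (Real.log (v / D) / 2 + δ))) ≤
        Real.exp (m * (Real.log (τ / q) / 2)) * Real.exp (-(m * (κ * ζ))) *
          Real.exp (-(m * (δ / 4))) := by
        rw [← Real.exp_add, ← Real.exp_add]
        refine Real.exp_le_exp.2 ?_
        have h9 : m * (κ * ζ) ≤ m * (δ / 4) := by gcongr
        have h10 : m * (-(Real.log (v / D)) - δ) ≤ m * Real.log (τ / q) := by gcongr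
        linarith
    _ ≤ Real.sqrt (τ / q) ^ m * Real.exp (-(m * (κ * ζ))) *
          (gaussLaw τ m).real {g | a • y + g ∈ G} := by
        rw [sqrt_pow_eq_exp (by positivity)]
        gcongr
        exact h8.trans hprob

/-- A random codeword is close to a vector `y` of power `q + D` with probability at least about
`exp (- m R(q + D, D))`. -/
lemma eventually_le_codewordLaw_ball (c : Codebook) {q D δ : ℝ} (hq : 0 < q) (hD : 0 < D)
    (hδ : 0 < δ) :
    ∃ η > 0, ∀ᶠ m : ℕ in atTop, ∀ y : Vec m, |‖y‖ ^ 2 - m * (q + D)| ≤ m * η →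
      Real.exp (-(m * (Real.log ((q + D) / D) / 2 + δ))) ≤
        (codewordLaw c q m).real {w | ‖y - w‖ ^ 2 ≤ m * (D - η)} := by
  obtain ⟨θ, hθ, hθD, h⟩ := eventually_le_gaussLaw_ball hq hD hδ
  -- The extra summand `t` leaves room for the shrunken squared radius `D - η` after the
  -- normalization error has been added.
  have hcont : Tendsto (fun t : ℝ => (Real.sqrt (D - θ) + t / Real.sqrt q) ^ 2 + t) (𝓝[>] 0)
      (𝓝 ((Real.sqrt (D - θ) + 0 / Real.sqrt q) ^ 2 + 0)) :=
    (Continuous.tendsto (by fun_prop) 0).mono_left nhdsWithin_le_nhds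
  have h0 : (Real.sqrt (D - θ) + 0 / Real.sqrt q) ^ 2 + 0 < D := by
    rw [zero_div, add_zero, add_zero, Real.sq_sqrt (by linarith)]; linarith
  obtain ⟨η', h1, hη'⟩ := (hcont.eventually (gt_mem_nhds h0)).and self_mem_nhdsWithin |>.exists
  have hη' : 0 < η' := hη'
  obtain ⟨η, hη, h⟩ := h η' hη'
  have hs := Real.sq_sqrt (show 0 ≤ D - θ by linarith)
  have hge : D - θ + η' ≤ D := by
    have : Real.sqrt (D - θ) ^ 2 ≤ (Real.sqrt (D - θ) + η' / Real.sqrt q) ^ 2 := by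
      gcongr
      have : 0 ≤ η' / Real.sqrt q := by positivity
      linarith
    linarith
  refine ⟨min η η', lt_min hη hη', ?_⟩
  filter_upwards [h, eventually_gt_atTop 0] with m hm hm0 y hy
  refine (hm y (hy.trans (by gcongr; exact min_le_left _ _))).trans ?_
  have hmin := min_le_right η η'
  cases c with
  | iid =>
    refine measureReal_mono fun w hw => ?_
    have hw : ‖y - w‖ ^ 2 ≤ m * (D - θ) := hw.1
    change ‖y - w‖ ^ 2 ≤ m * (D - min η η')
    refine hw.trans ?_
    gcongr
    linarith
  | sp =>
    rw [measureReal_def, measureReal_def, codewordLaw, uniformSphere_apply hq hm0 _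
      (measurableSet_norm_sub_sq_le y _)]
    refine ENNReal.toReal_mono (measure_ne_top _ _) (measure_mono fun w hw => ?_)
    exact norm_sq_le_of_norm_sub_le hw.1 (norm_sub_normalize_le hq hm0 hw.2)
      (by linarith)

/-! ### Product measures -/

lemma prod_real_le_of_sections {α β : Type*} [MeasurableSpace α] [MeasurableSpace β]
    (μ : Measure α) (ν : Measure β) [IsProbabilityMeasure μ] [IsProbabilityMeasure ν]
    {S : Set (α × β)} (hS : MeasurableSet S) {B : Set α} (hB : MeasurableSet B) {c : ℝ}
    (hc : 0 ≤ c) (h : ∀ x ∉ B, ν.real {y | (x, y) ∈ S} ≤ c) :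
    (μ.prod ν).real S ≤ μ.real B + c := by
  have h1 : (μ.prod ν) S ≤ μ B + ENNReal.ofReal c := by
    rw [Measure.prod_apply hS]
    calc ∫⁻ x, ν (Prod.mk x ⁻¹' S) ∂μ ≤ ∫⁻ x, (B.indicator 1 x + ENNReal.ofReal c) ∂μ := by
          refine lintegral_mono fun x => ?_
          by_cases hx : x ∈ B
          · rw [Set.indicator_of_mem hx]
            exact prob_le_one.trans le_self_add
          · rw [Set.indicator_of_notMem hx, zero_add]
            refine (ENNReal.le_ofReal_iff_toReal_le (measure_ne_top _ _) hc).2 (h x hx)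
      _ = μ B + ENNReal.ofReal c := by
          rw [lintegral_add_right _ measurable_const, lintegral_indicator_one hB, lintegral_const,
            measure_univ, mul_one]
  have h2 := ENNReal.toReal_mono (by finiteness) h1
  rwa [ENNReal.toReal_add (measure_ne_top _ _) ENNReal.ofReal_ne_top,
    ENNReal.toReal_ofReal hc] at h2

lemma prod_real_le_of_sections_symm {α β : Type*} [MeasurableSpace α] [MeasurableSpace β]
    (μ : Measure α) (ν : Measure β) [IsProbabilityMeasure μ] [IsProbabilityMeasure ν]
    {S : Set (α × β)} (hS : MeasurableSet S) {B : Set β} (hB : MeasurableSet B) {c : ℝ}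
    (hc : 0 ≤ c) (h : ∀ y ∉ B, μ.real {x | (x, y) ∈ S} ≤ c) :
    (μ.prod ν).real S ≤ ν.real B + c := by
  have h1 : (μ.prod ν).real S = (ν.prod μ).real (Prod.swap ⁻¹' S) := by
    rw [measureReal_def, measureReal_def, ← Measure.prod_swap,
      Measure.map_apply measurable_swap hS]
  rw [h1]
  exact prod_real_le_of_sections ν μ (measurable_swap hS) hB hc h

section Pi

variable {ι α : Type*} [Fintype ι] [MeasurableSpace α]

/-- Replacing one coordinate of an i.i.d. family by an independent copy does not change its law. -/
lemma measurePreserving_update [DecidableEq ι] (ν : Measure α) [IsProbabilityMeasure ν] (i : ι) :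
    MeasurePreserving (fun p : α × (ι → α) => Function.update p.2 i p.1)
      (ν.prod (Measure.pi fun _ : ι => ν)) (Measure.pi fun _ : ι => ν) := by
  have hm : Measurable fun p : α × (ι → α) => Function.update p.2 i p.1 := by
    refine measurable_pi_iff.2 fun j => ?_
    rcases eq_or_ne j i with rfl | hj
    · simpa using measurable_fst
    · simp only [Function.update_of_ne hj]
      exact (measurable_pi_apply j).comp measurable_snd
  refine ⟨hm, (Measure.pi_eq fun s hs => ?_).symm⟩
  rw [Measure.map_apply hm (MeasurableSet.univ_pi hs)]
  have h1 : (fun p : α × (ι → α) => Function.update p.2 i p.1) ⁻¹' Set.univ.pi s =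
      s i ×ˢ Set.univ.pi (Function.update s i Set.univ) := by
    ext p
    simp only [Set.mem_preimage, Set.mem_univ_pi, Set.mem_prod]
    constructor
    · intro h
      refine ⟨by simpa using h i, fun j => ?_⟩
      rcases eq_or_ne j i with rfl | hj
      · simp
      · simpa [Function.update_of_ne hj] using h j
    · rintro ⟨h1, h2⟩ j
      rcases eq_or_ne j i with rfl | hj
      · simpa using h1
      · simpa [Function.update_of_ne hj] using h2 j
  rw [h1, Measure.prod_prod, Measure.pi_pi, ← Finset.mul_prod_erase _ _ (Finset.mem_univ i),
    ← Finset.mul_prod_erase (a := i) _ (fun j => ν (s j)) (Finset.mem_univ i)]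
  simp only [Function.update_self, measure_univ, one_mul]
  congr 1
  refine Finset.prod_congr rfl fun j hj => ?_
  rw [Function.update_of_ne (Finset.ne_of_mem_erase hj)]

lemma pi_real_forall_mem (ν : Measure α) [IsProbabilityMeasure ν] (s : Finset ι) (V : Set α) :
    (Measure.pi fun _ : ι => ν).real {x | ∀ i ∈ s, x i ∈ V} = ν.real V ^ s.card := by
  classical
  have h1 : {x : ι → α | ∀ i ∈ s, x i ∈ V} =
      Set.univ.pi fun i => if i ∈ s then V else Set.univ := by
    ext x
    simp only [Set.mem_ofPred_eq, Set.mem_univ_pi]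
    refine forall_congr' fun i => ?_
    by_cases hi : i ∈ s <;> simp [hi]
  rw [measureReal_def, h1, Measure.pi_pi, ENNReal.toReal_prod, measureReal_def]
  have h2 : ∀ i, (ν (if i ∈ s then V else Set.univ)).toReal =
      if i ∈ s then (ν V).toReal else 1 := by
    intro i; split_ifs <;> simp
  simp only [h2]
  rw [Finset.prod_ite_mem, Finset.univ_inter, Finset.prod_const]

end Pi

/-- Either `U` misses `L` or `U` contains all of `Lᶜ`. In the second case `P(U) = P(U ∩ L) + 1 -
P(L)`, and the inequality reduces to `P(U ∩ L) ≤ P(L)`. -/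
lemma real_inter_le_of_compl_subset {α : Type*} [MeasurableSpace α] (ν : Measure α)
    [IsProbabilityMeasure ν] {U L : Set α} (hL : MeasurableSet L)
    (h : (U ∩ L).Nonempty → Lᶜ ⊆ U) : ν.real (U ∩ L) ≤ ν.real U * ν.real L := by
  rcases (U ∩ L).eq_empty_or_nonempty with h0 | h0
  · rw [h0, measureReal_empty]; positivity
  have h1 : U \ L = Lᶜ := by
    ext a
    exact ⟨fun ha => ha.2, fun ha => ⟨h h0 ha, ha⟩⟩
  have h2 := measureReal_inter_add_sdiff (μ := ν) (s := U) hL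
  rw [h1, probReal_compl_eq_one_sub hL] at h2
  have h3 : ν.real (U ∩ L) ≤ ν.real L := measureReal_mono Set.inter_subset_right
  have h4 : ν.real L ≤ 1 := measureReal_le_one
  nlinarith

/-! ### Minimizers -/

section ArgMin

variable {ι : Type} [Fintype ι] [LinearOrder ι] [Nonempty ι]

lemma argMin_le_apply (g : ι → ℝ) (b : ι) : g (argMin g) ≤ g b := by
  have h := Finset.min'_mem (Finset.univ.filter fun a => ∀ b, g a ≤ g b)
    (by obtain ⟨a, ha⟩ := Finite.exists_min g; exact ⟨a, by simpa using ha⟩)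
  exact (Finset.mem_filter.1 h).2 b

lemma argMin_le (g : ι → ℝ) {a : ι} (ha : ∀ b, g a ≤ g b) : argMin g ≤ a :=
  Finset.min'_le _ _ (by simpa using ha)

lemma argMin_eq_iff (g : ι → ℝ) (a : ι) :
    argMin g = a ↔ (∀ b, g a ≤ g b) ∧ ∀ a' < a, ∃ b, g b < g a' := by
  constructor
  · rintro rfl
    refine ⟨argMin_le_apply g, fun a' ha' => ?_⟩
    by_contra! h
    exact absurd ha' (not_lt.2 (argMin_le g h))
  · rintro ⟨h1, h2⟩
    refine le_antisymm (argMin_le g h1) (not_lt.1 fun h => ?_)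
    obtain ⟨b, hb⟩ := h2 _ h
    exact absurd hb (not_lt.2 (argMin_le_apply g b))

/-- Raising the values of the competitors does not dethrone the winner, ties included. -/
lemma argMin_eq_of_le {g g' : ι → ℝ} {a : ι} (h : argMin g = a) (ha : g' a = g a)
    (hle : ∀ b, g b ≤ g' b) : argMin g' = a := by
  subst h
  refine le_antisymm (argMin_le g' fun b => ?_) (argMin_le g fun b => ?_)
  · rw [ha]; exact (argMin_le_apply g b).trans (hle b)
  · calc g (argMin g') ≤ g' (argMin g') := hle _
      _ ≤ g' (argMin g) := argMin_le_apply g' _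
      _ = g (argMin g) := ha
      _ ≤ g b := argMin_le_apply g b

lemma measurableSet_argMin_eq {Ω : Type*} [MeasurableSpace Ω] {g : Ω → ι → ℝ}
    (hg : ∀ i, Measurable fun ω => g ω i) (a : ι) : MeasurableSet {ω | argMin (g ω) = a} := by
  simp only [argMin_eq_iff]
  refine MeasurableSet.inter ?_ ?_
  · exact MeasurableSet.iInter (f := fun b => {ω | g ω a ≤ g ω b})
      (fun b => measurableSet_le (hg a) (hg b)) |>.congr
      (by ext; simp only [Set.mem_iInter, Set.mem_ofPred_eq]; rfl)
  · have : ∀ a' : ι, MeasurableSet {ω | ∃ b, g ω b < g ω a'} := fun a' =>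
      (MeasurableSet.iUnion (f := fun b => {ω | g ω b < g ω a'})
        fun b => measurableSet_lt (hg b) (hg a')).congr (by ext; simp)
    exact (MeasurableSet.iInter fun a' => MeasurableSet.iInter fun _ : a' < a => this a').congr
      (by ext; simp only [Set.mem_iInter, Set.mem_ofPred_eq]; rfl)

end ArgMin

/-! ### The regularized nearest neighbor decoder -/

section Decoder

variable {ι : Type} [Fintype ι] [LinearOrder ι] [Nonempty ι] {n : ℕ}

/-- The decoder errs with small probability if a fresh codeword rarely beats the one sent. -/
lemma argMin_ne_le (ν ρ : Measure (Vec n)) [IsProbabilityMeasure ν] [IsProbabilityMeasure ρ]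
    (c : ι → ℝ) (m : ι) {G : Set (Vec n × Vec n)} (hG : MeasurableSet G) {α β : ℝ} (hβ : 0 ≤ β)
    (hα : (ν.prod ρ).real Gᶜ ≤ α)
    (h : ∀ p ∈ G, ∀ m', ν.real {x | ‖x - (p.1 + p.2)‖ ^ 2 + c m' ≤ ‖p.2‖ ^ 2 + c m} ≤ β) :
    ((Measure.pi fun _ : ι => ν).prod ρ).real
      {p | argMin (fun m' => ‖p.1 m' - (p.1 m + p.2)‖ ^ 2 + c m') ≠ m} ≤
        α + Fintype.card ι * β := by
  set Q := (Measure.pi fun _ : ι => ν).prod ρ with hQ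
  set E : ι → Set ((ι → Vec n) × Vec n) := fun m' => {p | (p.1 m, p.2) ∈ G ∧
    ‖p.1 m' - (p.1 m + p.2)‖ ^ 2 + c m' ≤ ‖p.2‖ ^ 2 + c m} with hE
  have hsub : {p : (ι → Vec n) × Vec n |
      argMin (fun m' => ‖p.1 m' - (p.1 m + p.2)‖ ^ 2 + c m') ≠ m} ⊆
      {p | (p.1 m, p.2) ∈ Gᶜ} ∪ ⋃ m' ∈ Finset.univ.erase m, E m' := by
    intro p hp
    by_cases hpG : (p.1 m, p.2) ∈ G
    · refine Or.inr (Set.mem_biUnion (Finset.mem_coe.2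
        (Finset.mem_erase.2 ⟨hp, Finset.mem_univ _⟩)) ⟨hpG, ?_⟩)
      -- The message sent scores `‖z‖² + c m`, so a different winner must score at most that.
      have h1 := argMin_le_apply (fun m' => ‖p.1 m' - (p.1 m + p.2)‖ ^ 2 + c m') m
      simpa using h1
    · exact Or.inl hpG
  have hmp : MeasurePreserving (fun p : (ι → Vec n) × Vec n => (p.1 m, p.2)) Q (ν.prod ρ) :=
    (measurePreserving_eval (fun _ : ι => ν) m).prod (MeasurePreserving.id ρ)
  have hfirst : Q.real {p | (p.1 m, p.2) ∈ Gᶜ} ≤ α := by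
    refine le_trans (le_of_eq ?_) hα
    exact congrArg ENNReal.toReal (hmp.measure_preimage hG.compl.nullMeasurableSet)
  have hEm : ∀ m', MeasurableSet (E m') := fun m' =>
    (hmp.measurable hG).inter (measurableSet_le
      (f := fun p : (ι → Vec n) × Vec n => ‖p.1 m' - (p.1 m + p.2)‖ ^ 2 + c m')
      (g := fun p => ‖p.2‖ ^ 2 + c m) (by fun_prop) (by fun_prop))
  have hEle : ∀ m' ∈ Finset.univ.erase m, Q.real (E m') ≤ β := by
    intro m' hm'
    have hne : m' ≠ m := Finset.ne_of_mem_erase hm'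
    refine (prod_real_le_of_sections_symm _ _ (hEm m') MeasurableSet.empty hβ
      fun z _ => ?_).trans (by simp)
    have hmz : MeasurableSet {x : ι → Vec n | (x, z) ∈ E m'} :=
      measurable_prodMk_right (hEm m')
    -- Resampling coordinate `m` makes the codeword sent explicit. With it and the noise fixed,
    -- coordinate `m' ≠ m` still has law `ν`.
    have hup := measurePreserving_update (ι := ι) ν m
    rw [measureReal_def, ← hup.measure_preimage hmz.nullMeasurableSet, ← measureReal_def]
    refine (prod_real_le_of_sections _ _ (hup.measurable hmz) MeasurableSet.empty hβ
      fun a _ => ?_).trans (by simp)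
    by_cases haG : (a, z) ∈ G
    · have hev := measurePreserving_eval (fun _ : ι => ν) m'
      have hV : MeasurableSet {x : Vec n | ‖x - (a + z)‖ ^ 2 + c m' ≤ ‖z‖ ^ 2 + c m} :=
        measurableSet_le (by fun_prop) measurable_const
      refine le_trans ?_ (h (a, z) haG m')
      rw [measureReal_def, measureReal_def, ← hev.measure_preimage hV.nullMeasurableSet]
      refine ENNReal.toReal_mono (measure_ne_top _ _) (measure_mono fun x hx => ?_)
      have hx := hx.2
      simpa [Function.update_of_ne hne] using hx
    · refine le_trans (le_of_eq ?_) hβ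
      convert measureReal_empty (μ := Measure.pi fun _ : ι => ν)
      ext x
      simp [hE, haG]
  calc Q.real _ ≤ Q.real ({p | (p.1 m, p.2) ∈ Gᶜ} ∪ ⋃ m' ∈ Finset.univ.erase m, E m') :=
        measureReal_mono hsub
    _ ≤ Q.real {p | (p.1 m, p.2) ∈ Gᶜ} + Q.real (⋃ m' ∈ Finset.univ.erase m, E m') :=
        measureReal_union_le _ _
    _ ≤ α + ∑ m' ∈ Finset.univ.erase m, Q.real (E m') :=
        add_le_add hfirst (measureReal_biUnion_finset_le _ _)
    _ ≤ α + Fintype.card ι * β := by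
        gcongr
        refine (Finset.sum_le_card_nsmul _ _ _ hEle).trans ?_
        rw [nsmul_eq_mul]
        gcongr
        exact Finset.card_le_univ _

/-- The decoder succeeds with small probability if a fresh codeword beats the one sent with
probability much more than the inverse of the number of competitors. -/
lemma argMin_eq_le (ν ρ : Measure (Vec n)) [IsProbabilityMeasure ν] [IsProbabilityMeasure ρ]
    (c : ι → ℝ) (m : ι) {s : Finset ι} (hs : m ∉ s) (hc : ∀ m' ∈ s, c m' = c m)
    {G : Set (Vec n × Vec n)} (hG : MeasurableSet G) {α β : ℝ} (hβ : β ≤ 1)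
    (hα : (ν.prod ρ).real Gᶜ ≤ α)
    (h : ∀ p ∈ G, β ≤ ν.real {x | ‖x - (p.1 + p.2)‖ ^ 2 < ‖p.2‖ ^ 2}) :
    ((Measure.pi fun _ : ι => ν).prod ρ).real
      {p | argMin (fun m' => ‖p.1 m' - (p.1 m + p.2)‖ ^ 2 + c m') = m} ≤
        α + (1 - β) ^ s.card := by
  set Q := (Measure.pi fun _ : ι => ν).prod ρ with hQ
  set E : Set ((ι → Vec n) × Vec n) := {p | (p.1 m, p.2) ∈ G ∧ ∀ m' ∈ s,
    ‖p.2‖ ^ 2 ≤ ‖p.1 m' - (p.1 m + p.2)‖ ^ 2} with hE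
  have hsub : {p : (ι → Vec n) × Vec n |
      argMin (fun m' => ‖p.1 m' - (p.1 m + p.2)‖ ^ 2 + c m') = m} ⊆
      {p | (p.1 m, p.2) ∈ Gᶜ} ∪ E := by
    intro p hp
    by_cases hpG : (p.1 m, p.2) ∈ G
    · refine Or.inr ⟨hpG, fun m' hm' => ?_⟩
      have h1 := argMin_le_apply (fun m' => ‖p.1 m' - (p.1 m + p.2)‖ ^ 2 + c m') m'
      rw [show argMin (fun m' => ‖p.1 m' - (p.1 m + p.2)‖ ^ 2 + c m') = m from hp] at h1
      simpa [hc m' hm'] using h1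
    · exact Or.inl hpG
  have hmp : MeasurePreserving (fun p : (ι → Vec n) × Vec n => (p.1 m, p.2)) Q (ν.prod ρ) :=
    (measurePreserving_eval (fun _ : ι => ν) m).prod (MeasurePreserving.id ρ)
  have hfirst : Q.real {p | (p.1 m, p.2) ∈ Gᶜ} ≤ α := by
    refine le_trans (le_of_eq ?_) hα
    exact congrArg ENNReal.toReal (hmp.measure_preimage hG.compl.nullMeasurableSet)
  have hEm : MeasurableSet E := by
    refine (hmp.measurable hG).inter ?_
    refine (MeasurableSet.iInter fun m' => MeasurableSet.iInter fun _ : m' ∈ s =>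
      measurableSet_le (f := fun p : (ι → Vec n) × Vec n => ‖p.2‖ ^ 2)
      (g := fun p => ‖p.1 m' - (p.1 m + p.2)‖ ^ 2) (by fun_prop) (by fun_prop)).congr ?_
    ext; simp only [Set.mem_iInter, Set.mem_ofPred_eq]; rfl
  have hpow : 0 ≤ (1 - β) ^ s.card := pow_nonneg (by linarith) _
  have hEle : Q.real E ≤ (1 - β) ^ s.card := by
    refine (prod_real_le_of_sections_symm _ _ hEm MeasurableSet.empty hpow
      fun z _ => ?_).trans (by simp)
    have hmz : MeasurableSet {x : ι → Vec n | (x, z) ∈ E} := measurable_prodMk_right hEm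
    have hup := measurePreserving_update (ι := ι) ν m
    rw [measureReal_def, ← hup.measure_preimage hmz.nullMeasurableSet, ← measureReal_def]
    refine (prod_real_le_of_sections _ _ (hup.measurable hmz) MeasurableSet.empty hpow
      fun a _ => ?_).trans (by simp)
    by_cases haG : (a, z) ∈ G
    · have hV : MeasurableSet {x : Vec n | ‖x - (a + z)‖ ^ 2 < ‖z‖ ^ 2} :=
        measurableSet_lt (by fun_prop) measurable_const
      have h1 : ν.real {x : Vec n | ‖x - (a + z)‖ ^ 2 < ‖z‖ ^ 2}ᶜ ≤ 1 - β := by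
        rw [probReal_compl_eq_one_sub hV]
        linarith [h (a, z) haG]
      refine le_trans ?_ (pow_le_pow_left₀ measureReal_nonneg h1 _)
      -- With the sent codeword and the noise fixed, the competitors are independent, so the
      -- probability that none of them wins is a power.
      rw [← pi_real_forall_mem]
      refine measureReal_mono fun x hx m' hm' => ?_
      have hne : m' ≠ m := fun h => hs (h ▸ hm')
      have hx := hx.2 m' hm'
      simpa [Function.update_of_ne hne] using hx
    · refine le_trans (le_of_eq ?_) hpow
      convert measureReal_empty (μ := Measure.pi fun _ : ι => ν)
      ext x
      simp [hE, haG]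
  calc Q.real _ ≤ Q.real ({p | (p.1 m, p.2) ∈ Gᶜ} ∪ E) := measureReal_mono hsub
    _ ≤ _ := (measureReal_union_le _ _).trans (add_le_add hfirst hEle)

end Decoder

/-! ### The source encoder -/

section Encoder

variable {k N : ℕ} {M : Fin N → ℕ}

/-- The index of the source codeword closest to `s` within the sub-codebook `i`, which contains the
index `j`. -/
def nearest (s : Vec k) (src : Message M → Vec k) {i : Fin N} (j : Fin (M i)) : Fin (M i) :=
  haveI : Nonempty (Fin (M i)) := ⟨j⟩
  argMin fun j' => ‖s - src (toLex ⟨i, j'⟩)‖ ^ 2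

lemma typeClass_unique {level : ℕ → ℝ} (hl : Monotone level) {s : Vec k} {i i' : ℕ}
    (h : s ∈ typeClass k level i) (h' : s ∈ typeClass k level i') : i = i' := by
  by_contra hne
  rcases lt_or_gt_of_ne hne with h1 | h1
  · exact absurd (h.2.trans_le (hl h1)) (not_lt.2 h'.1)
  · exact absurd (h'.2.trans_le (hl h1)) (not_lt.2 h.1)

lemma encode_of_mem {level : ℕ → ℝ} (hl : Monotone level) {s : Vec k} {i : Fin N}
    (hi : s ∈ typeClass k level i) (j : Fin (M i)) (src : Message M → Vec k) :
    encode level M s src = some (toLex ⟨i, nearest s src j⟩) := by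
  have h : ∃ i : Fin N, s ∈ typeClass k level i ∧ 0 < M i := ⟨i, hi, Fin.pos j⟩
  -- The class picked by `choose` is not explicit, so the claim is proved for every admissible
  -- class; monotone levels leave only one.
  have key : ∀ (i₀ : Fin N) (h₀ : s ∈ typeClass k level i₀ ∧ 0 < M i₀),
      some (toLex (⟨i₀, @argMin _ _ _ ⟨⟨0, h₀.2⟩⟩ fun j => ‖s - src (toLex ⟨i₀, j⟩)‖ ^ 2⟩ :
        Σ i, Fin (M i))) = some (toLex ⟨i, nearest s src j⟩) := by
    intro i₀ h₀
    obtain rfl : i₀ = i := Fin.ext (typeClass_unique hl h₀.1 hi)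
    rfl
  rw [encode, dif_pos h]
  exact key _ h.choose_spec

lemma excess_of_forall_notMem {n : ℕ} {level : ℕ → ℝ} {D : ℝ} {s : Vec k}
    (h : ¬ ∃ i : Fin N, s ∈ typeClass k level i ∧ 0 < M i) (src : Message M → Vec k)
    (chan : Message M → Vec n) (z : Vec n) : Excess level M D s src chan z := by
  have : encode level M s src = none := by rw [encode, dif_neg h]
  simp [Excess, this]

/-- The message decoded when the message `m` is sent. -/
def received {n : ℕ} (chan : Message M → Vec n) (z : Vec n) (m : Message M) : Message M :=
  haveI : Nonempty (Message M) := ⟨m⟩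
  decode M chan (chan m + z)

lemma excess_iff_of_mem {n : ℕ} {level : ℕ → ℝ} (hl : Monotone level) {D : ℝ} {s : Vec k}
    {i : Fin N} (hi : s ∈ typeClass k level i) (j : Fin (M i)) (src : Message M → Vec k)
    (chan : Message M → Vec n) (z : Vec n) :
    Excess level M D s src chan z ↔
      D < distortion s (src (received chan z (toLex ⟨i, nearest s src j⟩))) := by
  simp only [Excess, encode_of_mem hl hi j src]
  rfl

/-- Writing success as a finite union over the type, the chosen index and the decoded message makes
its measurability evident. -/
lemma not_excess_iff {n : ℕ} {level : ℕ → ℝ} (hl : Monotone level) {D : ℝ} {s : Vec k}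
    (src : Message M → Vec k) (chan : Message M → Vec n) (z : Vec n) :
    ¬ Excess level M D s src chan z ↔ ∃ i : Fin N, ∃ j : Fin (M i), ∃ m : Message M,
      s ∈ typeClass k level i ∧ nearest s src j = j ∧ received chan z (toLex ⟨i, j⟩) = m ∧
        distortion s (src m) ≤ D := by
  constructor
  · intro h
    have h' : ∃ i : Fin N, s ∈ typeClass k level i ∧ 0 < M i := by
      by_contra h0
      exact h (excess_of_forall_notMem h0 src chan z)
    obtain ⟨i, hi, hM⟩ := h'
    rw [excess_iff_of_mem hl hi ⟨0, hM⟩, not_lt] at h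
    exact ⟨i, nearest s src ⟨0, hM⟩, _, hi, rfl, rfl, h⟩
  · rintro ⟨i, j, m, hi, hj, rfl, h⟩
    rw [excess_iff_of_mem hl hi j, hj, not_lt]
    exact h

lemma measurableSet_typeClass (level : ℕ → ℝ) (i : ℕ) : MeasurableSet (typeClass k level i) :=
  (measurableSet_le (f := fun _ => level i) (g := fun s : Vec k => ‖s‖ ^ 2 / k) (by fun_prop)
    (by fun_prop)).inter (measurableSet_lt (f := fun s : Vec k => ‖s‖ ^ 2 / k) (by fun_prop)
      measurable_const)

lemma measurableSet_nearest_eq {Ω : Type*} [MeasurableSpace Ω] {s : Ω → Vec k}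
    {src : Ω → Message M → Vec k} (hs : Measurable s) (hsrc : Measurable src) {i : Fin N}
    (j j' : Fin (M i)) : MeasurableSet {ω | nearest (s ω) (src ω) j = j'} := by
  have : Nonempty (Fin (M i)) := ⟨j⟩
  exact measurableSet_argMin_eq (g := fun ω j' => ‖s ω - src ω (toLex ⟨i, j'⟩)‖ ^ 2)
    (fun j' => by fun_prop) j'

lemma measurableSet_received_eq {n : ℕ} {Ω : Type*} [MeasurableSpace Ω] {z : Ω → Vec n}
    {chan : Ω → Message M → Vec n} (hz : Measurable z) (hchan : Measurable chan)
    (m m' : Message M) : MeasurableSet {ω | received (chan ω) (z ω) m = m'} := by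
  have : Nonempty (Message M) := ⟨m⟩
  exact measurableSet_argMin_eq (g := fun ω m' => ‖chan ω m' - (chan ω m + z ω)‖ ^ 2 +
    2 * Real.log (M (ofLex m').1)) (fun m' => by fun_prop) m'

lemma measurableSet_distortion_le (s : Vec k) (D : ℝ) :
    MeasurableSet {w : Vec k | distortion s w ≤ D} := by
  refine measurableSet_le (f := fun w => distortion s w) ?_ measurable_const
  unfold distortion
  fun_prop

lemma measurableSet_not_excess {n : ℕ} {level : ℕ → ℝ} (hl : Monotone level) (D : ℝ) :
    MeasurableSet {ω : Vec k × (Message M → Vec k) × (Message M → Vec n) × Vec n |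
      ¬ Excess level M D ω.1 ω.2.1 ω.2.2.1 ω.2.2.2} := by
  let Ω := Vec k × (Message M → Vec k) × (Message M → Vec n) × Vec n
  have hs : Measurable fun ω : Ω => ω.1 := measurable_fst
  have hsrc : Measurable fun ω : Ω => ω.2.1 := measurable_fst.comp measurable_snd
  have hchan : Measurable fun ω : Ω => ω.2.2.1 :=
    measurable_fst.comp (measurable_snd.comp measurable_snd)
  have hz : Measurable fun ω : Ω => ω.2.2.2 :=
    measurable_snd.comp (measurable_snd.comp measurable_snd)
  have h1 : ∀ i : Fin N, MeasurableSet {ω : Ω | ω.1 ∈ typeClass k level i} := fun i =>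
    hs (measurableSet_typeClass level i)
  have h2 : ∀ (i : Fin N) (j : Fin (M i)), MeasurableSet {ω : Ω | nearest ω.1 ω.2.1 j = j} :=
    fun i j => measurableSet_nearest_eq hs hsrc j j
  have h3 : ∀ (i : Fin N) (j : Fin (M i)) (m : Message M),
      MeasurableSet {ω : Ω | received ω.2.2.1 ω.2.2.2 (toLex ⟨i, j⟩ : Message M) = m} :=
    fun i j m => measurableSet_received_eq hz hchan _ m
  have h4 : ∀ m : Message M, MeasurableSet {ω : Ω | distortion ω.1 (ω.2.1 m) ≤ D} := by
    intro m
    have hd : Measurable fun ω : Ω => ω.1 - ω.2.1 m :=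
      hs.sub ((measurable_pi_apply m).comp hsrc)
    exact measurableSet_le ((hd.norm.pow_const 2).div_const _) measurable_const
  have h5 := MeasurableSet.iUnion fun i : Fin N => MeasurableSet.iUnion fun j : Fin (M i) =>
    MeasurableSet.iUnion fun m : Message M => (h1 i).inter ((h2 i j).inter ((h3 i j m).inter (h4 m)))
  convert h5 using 1
  ext ω
  simp only [Set.mem_iUnion, Set.mem_inter_iff, Set.mem_ofPred_eq, not_excess_iff hl]
  exact Iff.rfl

/-! ### Conditioning on the source sequence -/

/-- Whether another codeword is close to `s` is negatively correlated with the index chosen by the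
encoder. -/
lemma pi_real_nearest_inter_le (ν : Measure (Vec k)) [IsProbabilityMeasure ν] (s : Vec k) (D : ℝ)
    {i : Fin N} (j : Fin (M i)) {m : Message M} (hm : m ≠ toLex ⟨i, j⟩) :
    (Measure.pi fun _ : Message M => ν).real
      {src | nearest s src j = j ∧ distortion s (src m) ≤ D} ≤
      (Measure.pi fun _ : Message M => ν).real {src | nearest s src j = j} *
        ν.real {w | distortion s w ≤ D} := by
  classical
  set B := Measure.pi fun _ : Message M => ν with hB
  set L := {w : Vec k | distortion s w ≤ D} with hL
  have hLm : MeasurableSet L := measurableSet_distortion_le s D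
  set S := {src : Message M → Vec k | nearest s src j = j} with hS
  have hSm : MeasurableSet S := measurableSet_nearest_eq measurable_const measurable_id j j
  have hSLm : MeasurableSet {src : Message M → Vec k | nearest s src j = j ∧
      distortion s (src m) ≤ D} :=
    hSm.inter (show MeasurableSet {src : Message M → Vec k | src m ∈ L} from
      measurable_pi_apply m hLm)
  have hup := measurePreserving_update (ι := Message M) ν m
  have key : ∀ src : Message M → Vec k,
      ν ((fun a => Function.update src m a) ⁻¹' {src | nearest s src j = j ∧
        distortion s (src m) ≤ D}) ≤
      ν ((fun a => Function.update src m a) ⁻¹' S) * ν L := by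
    intro src
    -- Only codeword `m` varies. If `j` wins while `m` is close to `s`, then `j` still wins when `m`
    -- is replaced by a codeword outside the distortion ball, since that only moves a competitor
    -- away, if `m` competes at all.
    have h1 := real_inter_le_of_compl_subset ν
      (U := (fun a => Function.update src m a) ⁻¹' S) hLm (by
        rintro ⟨a, haS, haL⟩ b hb
        have : Nonempty (Fin (M i)) := ⟨j⟩
        have hlt : ‖s - a‖ ^ 2 ≤ ‖s - b‖ ^ 2 := by
          by_contra! hcon
          refine hb (show distortion s b ≤ D from le_trans ?_ (show distortion s a ≤ D from haL))
          simp only [distortion]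
          gcongr
        refine argMin_eq_of_le (a := j) (show argMin (fun j' =>
          ‖s - Function.update src m a (toLex ⟨i, j'⟩)‖ ^ 2) = j from haS) ?_ fun j' => ?_
        · simp only [Function.update_of_ne hm.symm]
        · by_cases hj : toLex (⟨i, j'⟩ : Σ i, Fin (M i)) = m
          · rw [hj]; simpa using hlt
          · simp only [Function.update_of_ne hj, le_refl])
    have h2 : (fun a => Function.update src m a) ⁻¹' {src | nearest s src j = j ∧
        distortion s (src m) ≤ D} = (fun a => Function.update src m a) ⁻¹' S ∩ L := by
      ext a
      simp [hS, hL]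
    rw [h2]
    rw [measureReal_def, measureReal_def, measureReal_def, ← ENNReal.toReal_mul] at h1
    exact (ENNReal.toReal_le_toReal (measure_ne_top _ _)
      (ENNReal.mul_ne_top (measure_ne_top _ _) (measure_ne_top _ _))).1 h1
  rw [measureReal_def, measureReal_def, measureReal_def, ← ENNReal.toReal_mul]
  refine ENNReal.toReal_mono (ENNReal.mul_ne_top (measure_ne_top _ _) (measure_ne_top _ _)) ?_
  rw [← hup.measure_preimage hSLm.nullMeasurableSet, ← hup.measure_preimage hSm.nullMeasurableSet,
    Measure.prod_apply_symm (hup.measurable hSLm), Measure.prod_apply_symm (hup.measurable hSm),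
    ← lintegral_mul_const _ (measurable_measure_prodMk_right (hup.measurable hSm))]
  exact lintegral_mono key

lemma sum_pi_real_nearest (ν : Measure (Vec k)) [IsProbabilityMeasure ν] (s : Vec k)
    {i : Fin N} (hi : 0 < M i) :
    ∑ j : Fin (M i), (Measure.pi fun _ : Message M => ν).real {src | nearest s src j = j} = 1 := by
  set j₀ : Fin (M i) := ⟨0, hi⟩
  have h := sum_measureReal_preimage_singleton (μ := Measure.pi fun _ : Message M => ν)
    Finset.univ (f := fun src => nearest s src j₀)
    (fun j _ => measurableSet_nearest_eq measurable_const measurable_id j₀ j)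
  rw [Finset.coe_univ, Set.preimage_univ, probReal_univ] at h
  exact h

lemma sum_real_received_le {n : ℕ} (κ : Measure ((Message M → Vec n) × Vec n))
    [IsProbabilityMeasure κ] (m : Message M) (s : Finset (Message M)) :
    ∑ m' ∈ s, κ.real {p | received p.1 p.2 m = m'} ≤ 1 := by
  have h := sum_measureReal_preimage_singleton (μ := κ) s
    (f := fun p : (Message M → Vec n) × Vec n => received p.1 p.2 m)
    (fun m' _ => measurableSet_received_eq measurable_snd measurable_fst m m')
  calc _ = κ.real _ := h
    _ ≤ 1 := measureReal_le_one

/-- The messages of the same power type, apart from a given one. -/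
def competitors {i : Fin N} (j : Fin (M i)) : Finset (Message M) :=
  (Finset.univ.erase j).map ⟨fun j' => toLex ⟨i, j'⟩, fun a b h => by simpa using h⟩

lemma card_competitors {i : Fin N} (j : Fin (M i)) : (competitors j).card = M i - 1 := by
  rw [competitors, Finset.card_map, Finset.card_erase_of_mem (Finset.mem_univ j),
    Finset.card_univ, Fintype.card_fin]

lemma notMem_competitors {i : Fin N} (j : Fin (M i)) :
    (toLex ⟨i, j⟩ : Message M) ∉ competitors j := by
  intro h
  obtain ⟨j', hj', he⟩ := Finset.mem_map.1 h
  have he : (toLex ⟨i, j'⟩ : Message M) = toLex ⟨i, j⟩ := he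
  exact Finset.ne_of_mem_erase hj' (by simpa using he)

variable {n : ℕ} (ν : Measure (Vec k)) [IsProbabilityMeasure ν]
  (κ : Measure ((Message M → Vec n) × Vec n)) [IsProbabilityMeasure κ]

/-- Given the source sequence, excess distortion needs all codewords of its power type to be far
away, or a decoding error. -/
lemma prod_real_excess_le {level : ℕ → ℝ} (hl : Monotone level) {D δ : ℝ} {s : Vec k} {i : Fin N}
    (hi : s ∈ typeClass k level i) (hM : 0 < M i)
    (hδ : ∀ m : Message M, κ.real {p | received p.1 p.2 m ≠ m} ≤ δ) :
    ((Measure.pi fun _ : Message M => ν).prod κ).real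
      {p | Excess level M D s p.1 p.2.1 p.2.2} ≤
      (1 - ν.real {w | distortion s w ≤ D}) ^ M i + δ := by
  set B := Measure.pi fun _ : Message M => ν with hB
  set F : Finset (Message M) := Finset.univ.map
    ⟨fun j : Fin (M i) => (toLex ⟨i, j⟩ : Message M), fun a b h => by simpa using h⟩ with hF
  have hFc : F.card = M i := by simp [hF]
  set V := {w : Vec k | distortion s w ≤ D}ᶜ with hV
  have hsub : {p : (Message M → Vec k) × (Message M → Vec n) × Vec n |
      Excess level M D s p.1 p.2.1 p.2.2} ⊆
      {src | ∀ m ∈ F, src m ∈ V} ×ˢ Set.univ ∪ ⋃ j ∈ (Finset.univ : Finset (Fin (M i))),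
        {src | nearest s src j = j} ×ˢ
          {p | received p.1 p.2 (toLex ⟨i, j⟩ : Message M) ≠ toLex ⟨i, j⟩} := by
    rintro ⟨src, chan, z⟩ hp
    have hp : Excess level M D s src chan z := hp
    rw [excess_iff_of_mem hl hi ⟨0, hM⟩] at hp
    set j := nearest s src ⟨0, hM⟩ with hj
    by_cases hr : received chan z (toLex ⟨i, j⟩ : Message M) = toLex ⟨i, j⟩
    · refine Or.inl ⟨fun m hm => ?_, Set.mem_univ _⟩
      rw [hr] at hp
      obtain ⟨j', -, rfl⟩ := Finset.mem_map.1 hm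
      have : Nonempty (Fin (M i)) := ⟨j⟩
      have h1 : ‖s - src (toLex ⟨i, j⟩)‖ ^ 2 ≤ ‖s - src (toLex ⟨i, j'⟩)‖ ^ 2 :=
        argMin_le_apply (fun j' => ‖s - src (toLex ⟨i, j'⟩)‖ ^ 2) j'
      have h2 : D < distortion s (src (toLex ⟨i, j'⟩)) := by
        refine hp.trans_le ?_
        simp only [distortion]
        gcongr
      exact not_le.2 h2
    · exact Or.inr (Set.mem_biUnion (Finset.mem_coe.2 (Finset.mem_univ j)) ⟨rfl, hr⟩)
  calc (B.prod κ).real _ ≤ (B.prod κ).real ({src | ∀ m ∈ F, src m ∈ V} ×ˢ Set.univ) +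
        (B.prod κ).real (⋃ j ∈ (Finset.univ : Finset (Fin (M i))), {src | nearest s src j = j} ×ˢ
          {p | received p.1 p.2 (toLex ⟨i, j⟩ : Message M) ≠ toLex ⟨i, j⟩}) :=
        (measureReal_mono hsub).trans (measureReal_union_le _ _)
    -- The chosen index depends on the source codebook and the decoding error on the channel
    -- codebook, which are independent; so `δ` is averaged with the law of the index and no union
    -- bound is lost.
    _ ≤ (1 - ν.real {w | distortion s w ≤ D}) ^ M i +
        ∑ j : Fin (M i), B.real {src | nearest s src j = j} * δ := by
        refine add_le_add (le_of_eq ?_) ((measureReal_biUnion_finset_le _ _).trans ?_)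
        · rw [measureReal_prod_prod, probReal_univ, mul_one, pi_real_forall_mem, hFc, hV,
            probReal_compl_eq_one_sub (measurableSet_distortion_le s D)]
        · refine Finset.sum_le_sum fun j _ => ?_
          rw [measureReal_prod_prod]
          exact mul_le_mul_of_nonneg_left (hδ _) measureReal_nonneg
    _ = _ := by rw [← Finset.sum_mul, sum_pi_real_nearest ν s hM, one_mul]

/-- Given the source sequence, success needs correct decoding or a fresh codeword that happens to be
close to the source sequence. -/
lemma prod_real_not_excess_le {level : ℕ → ℝ} (hl : Monotone level) {D δ : ℝ} {s : Vec k}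
    {i : Fin N} (hi : s ∈ typeClass k level i) (hM : 0 < M i)
    (hδ : ∀ j : Fin (M i), κ.real {p | received p.1 p.2 (toLex ⟨i, j⟩) = toLex ⟨i, j⟩} ≤ δ) :
    ((Measure.pi fun _ : Message M => ν).prod κ).real
      {p | ¬ Excess level M D s p.1 p.2.1 p.2.2} ≤
      δ + ν.real {w | distortion s w ≤ D} := by
  classical
  set B := Measure.pi fun _ : Message M => ν with hB
  set p₀ := ν.real {w | distortion s w ≤ D} with hp₀
  set b : Fin (M i) → ℝ := fun j => B.real {src | nearest s src j = j} with hb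
  have hb0 : ∀ j, 0 ≤ b j := fun j => measureReal_nonneg
  have hb1 : ∑ j, b j = 1 := sum_pi_real_nearest ν s hM
  have hsub : {p : (Message M → Vec k) × (Message M → Vec n) × Vec n |
      ¬ Excess level M D s p.1 p.2.1 p.2.2} ⊆
      ⋃ j ∈ (Finset.univ : Finset (Fin (M i))), ({src | nearest s src j = j} ×ˢ
          {p | received p.1 p.2 (toLex ⟨i, j⟩ : Message M) = toLex ⟨i, j⟩} ∪
        ⋃ m ∈ Finset.univ.erase (toLex ⟨i, j⟩ : Message M),
          {src | nearest s src j = j ∧ distortion s (src m) ≤ D} ×ˢ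
          {p | received p.1 p.2 (toLex ⟨i, j⟩ : Message M) = m}) := by
    rintro ⟨src, chan, z⟩ hp
    have hp : ¬ Excess level M D s src chan z := hp
    rw [excess_iff_of_mem hl hi ⟨0, hM⟩, not_lt] at hp
    set j := nearest s src ⟨0, hM⟩ with hj
    refine Set.mem_biUnion (Finset.mem_coe.2 (Finset.mem_univ j)) ?_
    by_cases hr : received chan z (toLex ⟨i, j⟩ : Message M) = toLex ⟨i, j⟩
    · exact Or.inl ⟨rfl, hr⟩
    · exact Or.inr (Set.mem_biUnion (Finset.mem_coe.2 (Finset.mem_erase.2 ⟨hr, Finset.mem_univ _⟩))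
        ⟨⟨rfl, hp⟩, rfl⟩)
  have hj : ∀ j : Fin (M i), (B.prod κ).real ({src | nearest s src j = j} ×ˢ
          {p | received p.1 p.2 (toLex ⟨i, j⟩ : Message M) = toLex ⟨i, j⟩} ∪
        ⋃ m ∈ Finset.univ.erase (toLex ⟨i, j⟩ : Message M),
          {src | nearest s src j = j ∧ distortion s (src m) ≤ D} ×ˢ
          {p | received p.1 p.2 (toLex ⟨i, j⟩ : Message M) = m}) ≤ b j * (δ + p₀) := by
    intro j
    refine (measureReal_union_le _ _).trans ?_
    rw [mul_add]
    refine add_le_add ?_ ((measureReal_biUnion_finset_le _ _).trans ?_)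
    · rw [measureReal_prod_prod]
      exact mul_le_mul_of_nonneg_left (hδ j) (hb0 j)
    -- The decoded message is independent of the source codebook, and its probabilities sum to at
    -- most one. The exponentially many wrong messages therefore contribute `p₀` only once.
    · calc _ ≤ ∑ m ∈ Finset.univ.erase (toLex ⟨i, j⟩ : Message M),
            (b j * p₀) * κ.real {p | received p.1 p.2 (toLex ⟨i, j⟩ : Message M) = m} := by
            refine Finset.sum_le_sum fun m hm => ?_
            rw [measureReal_prod_prod]
            exact mul_le_mul_of_nonneg_right
              (pi_real_nearest_inter_le ν s D j (Finset.ne_of_mem_erase hm)) measureReal_nonneg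
        _ ≤ b j * p₀ := by
            rw [← Finset.mul_sum]
            exact mul_le_of_le_one_right (mul_nonneg (hb0 j) measureReal_nonneg)
              (sum_real_received_le κ _ _)
  calc _ ≤ _ := measureReal_mono hsub (measure_ne_top _ _)
    _ ≤ ∑ j, b j * (δ + p₀) :=
        (measureReal_biUnion_finset_le _ _).trans (Finset.sum_le_sum fun j _ => hj j)
    _ = δ + p₀ := by rw [← Finset.sum_mul, hb1, one_mul]

end Encoder

/-! ### Typical channel inputs and outputs -/

/-- The pairs of a channel input of power about `P` and a noise vector of power about `1` whose sum
has power about `P + 1`. -/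
def typicalPairs (P ζ : ℝ) (n : ℕ) : Set (Vec n × Vec n) :=
  {p | |‖p.1 + p.2‖ ^ 2 - n * (P + 1)| ≤ n * ζ ∧ |‖p.2‖ ^ 2 - n| ≤ n * ζ}

lemma measurableSet_typicalPairs (P ζ : ℝ) (n : ℕ) : MeasurableSet (typicalPairs P ζ n) := by
  unfold typicalPairs
  exact (measurableSet_le (f := fun p : Vec n × Vec n => |‖p.1 + p.2‖ ^ 2 - n * (P + 1)|)
    (by fun_prop) measurable_const).inter
    (measurableSet_le (f := fun p : Vec n × Vec n => |‖p.2‖ ^ 2 - n|) (by fun_prop)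
    measurable_const)

/-- The cross term `⟪x, z⟫` is controlled by the randomness of the codeword, uniformly over noise
vectors of bounded power. Of the noise itself only the norm must concentrate. -/
lemma eventually_typicalPairs (c : Codebook) {P : ℝ} (hP : 0 < P) (μ : Measure ℝ)
    [IsProbabilityMeasure μ] (hμ : MemLp (fun x : ℝ => x ^ 2) 2 μ) (hμ1 : ∫ x, x ^ 2 ∂μ = 1)
    {ζ ε : ℝ} (hζ : 0 < ζ) (hε : 0 < ε) :
    ∀ᶠ n : ℕ in atTop,
      ((codewordLaw c P n).prod (iidLaw μ n)).real (typicalPairs P ζ n)ᶜ ≤ ε := by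
  have hζ4 : 0 < ζ / 4 := by positivity
  filter_upwards [eventually_iidLaw_norm_sq μ hμ hζ4 (half_pos hε),
    eventually_codewordLaw_typical c hP (B := 1 + ζ / 4) hζ4 (half_pos hε),
    eventually_gt_atTop 0] with n h1 h2 hn
  have := isProbabilityMeasure_codewordLaw c P hn
  rw [hμ1, mul_one] at h1
  have hn0 : (0 : ℝ) ≤ n := Nat.cast_nonneg n
  have hnζ : 0 ≤ n * ζ := by positivity
  have hB : MeasurableSet {z : Vec n | ¬ |‖z‖ ^ 2 - n| ≤ n * (ζ / 4)} :=
    (measurableSet_le (f := fun z : Vec n => |‖z‖ ^ 2 - n|) (by fun_prop) measurable_const).compl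
  refine (prod_real_le_of_sections_symm _ _ (measurableSet_typicalPairs P ζ n).compl hB
    (half_pos hε).le fun z hz => ?_).trans ((add_le_add_left h1 _).trans (add_halves ε).le)
  have hz : |‖z‖ ^ 2 - n| ≤ n * (ζ / 4) := not_not.1 hz
  obtain ⟨hz1, hz2⟩ := abs_le.1 hz
  refine (measureReal_mono fun x hx => ?_).trans (h2 z (by linarith))
  rintro ⟨hx1, hx2⟩
  refine hx ?_
  rw [abs_le] at hx1 hx2
  refine ⟨?_, hz.trans (by linarith)⟩
  change |‖x + z‖ ^ 2 - n * (P + 1)| ≤ n * ζ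
  rw [norm_add_sq_real, real_inner_comm, abs_le]
  constructor <;> linarith

/-! ### The parameters -/

lemma tendsto_log_div_nat : Tendsto (fun k : ℕ => Real.log k / k) atTop (𝓝 0) := by
  have h := Real.isLittleO_log_id_atTop.tendsto_div_nhds_zero.comp tendsto_natCast_atTop_atTop
  exact h

lemma tendsto_xi : Tendsto xi atTop (𝓝 0) := by
  have h := tendsto_log_div_nat.sqrt
  rw [Real.sqrt_zero] at h
  exact h

lemma xi_le_one (k : ℕ) : xi k ≤ 1 := by
  refine Real.sqrt_le_one.2 ?_
  rcases k.eq_zero_or_pos with rfl | hk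
  · simp
  · exact div_le_one_of_le₀ ((Real.log_le_sub_one_of_pos (by exact_mod_cast hk)).trans
      (by linarith)) (Nat.cast_nonneg k)

lemma numTypes_le (k : ℕ) : numTypes k ≤ 2 * k := by
  refine Nat.ceil_le.2 ?_
  push_cast
  exact mul_le_of_le_one_right (by positivity) (xi_le_one k)

lemma monotone_powerLevel (σ : ℝ) (k : ℕ) : Monotone (powerLevel σ k) := by
  intro i j hij
  unfold powerLevel
  gcongr

lemma abs_powerLevel_sub_le (σ : ℝ) {k i : ℕ} (hk : 0 < k) (hi : i ≤ numTypes k) :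
    |powerLevel σ k i - σ ^ 2| ≤ (xi k + 1 / k) * σ ^ 2 := by
  have hk' : (0 : ℝ) < k := by exact_mod_cast hk
  have hxi : 0 ≤ xi k := Real.sqrt_nonneg _
  have h1 : (i : ℝ) / k ≤ 2 * xi k + 1 / k := by
    rw [div_le_iff₀ hk', add_mul, one_div, inv_mul_cancel₀ hk'.ne']
    have h2 : (i : ℝ) ≤ numTypes k := by exact_mod_cast hi
    have h3 : (numTypes k : ℝ) < 2 * k * xi k + 1 := Nat.ceil_lt_add_one (by positivity)
    linarith
  have h2 : 0 ≤ (i : ℝ) / k := by positivity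
  have h3 : powerLevel σ k i - σ ^ 2 = ((i : ℝ) / k - xi k) * σ ^ 2 := by unfold powerLevel; ring
  rw [h3, abs_mul, abs_of_nonneg (sq_nonneg σ)]
  refine mul_le_mul_of_nonneg_right (abs_le.2 ⟨?_, by linarith⟩) (sq_nonneg σ)
  have h4 : (0 : ℝ) < 1 / k := by positivity
  linarith

lemma eventually_abs_powerLevel_sub_le (σ : ℝ) {η : ℝ} (hη : 0 < η) :
    ∀ᶠ k : ℕ in atTop, ∀ i ≤ numTypes k, |powerLevel σ k i - σ ^ 2| ≤ η := by
  have h : Tendsto (fun k : ℕ => (xi k + 1 / (k : ℝ)) * σ ^ 2) atTop (𝓝 ((0 + 0) * σ ^ 2)) :=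
    (tendsto_xi.add tendsto_one_div_atTop_nhds_zero_nat).mul_const _
  rw [add_zero, zero_mul] at h
  filter_upwards [h.eventually (ge_mem_nhds hη), eventually_gt_atTop 0] with k hk hk0 i hi
  exact (abs_powerLevel_sub_le σ hk0 hi).trans hk

/-- Source sequences in the power type classes have power about `σ²`. -/
lemma eventually_abs_norm_sq_sub_le (σ : ℝ) {η : ℝ} (hη : 0 < η) :
    ∀ᶠ k : ℕ in atTop, ∀ i < numTypes k, ∀ s ∈ typeClass k (powerLevel σ k) i,
      |‖s‖ ^ 2 - k * σ ^ 2| ≤ k * η := by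
  filter_upwards [eventually_abs_powerLevel_sub_le σ hη, eventually_gt_atTop 0]
    with k hk hk0 i hi s hs
  have hk' : (0 : ℝ) < k := by exact_mod_cast hk0
  have h1 := (abs_le.1 (hk i hi.le)).1
  have h2 := (abs_le.1 (hk (i + 1) hi)).2
  have h3 := hs.1
  have h4 := hs.2
  rw [le_div_iff₀ hk'] at h3
  rw [div_lt_iff₀ hk'] at h4
  rw [abs_le]
  constructor <;> nlinarith

lemma exists_mem_typeClass {σ : ℝ} (hσ : 0 < σ) {k : ℕ} (hk : 0 < k) {s : Vec k}
    (hs : |‖s‖ ^ 2 - k * σ ^ 2| < k * (xi k * σ ^ 2)) :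
    ∃ i : Fin (numTypes k), s ∈ typeClass k (powerLevel σ k) i := by
  have hk' : (0 : ℝ) < k := by exact_mod_cast hk
  have hσ2 : 0 < σ ^ 2 := by positivity
  obtain ⟨h1, h2⟩ := abs_lt.1 hs
  -- The position of the power of `s` on the grid of levels; its integer part is the type.
  set t := k * (‖s‖ ^ 2 / k / σ ^ 2 - 1 + xi k) with ht
  have ht' : ‖s‖ ^ 2 / k = (1 - xi k + t / k) * σ ^ 2 := by
    rw [ht]; field_simp; ring
  have ht2 : t * σ ^ 2 = ‖s‖ ^ 2 - k * σ ^ 2 + k * (xi k * σ ^ 2) := by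
    rw [ht]; field_simp
  have ht0 : 0 ≤ t := by
    by_contra! h
    nlinarith
  have ht1 : t < numTypes k := by
    refine lt_of_lt_of_le ?_ (Nat.le_ceil _)
    by_contra! h
    nlinarith
  refine ⟨⟨⌊t⌋₊, (Nat.floor_lt ht0).2 ht1⟩, ?_, ?_⟩
  · rw [ht']
    unfold powerLevel
    gcongr
    exact Nat.floor_le ht0
  · rw [ht']
    unfold powerLevel
    gcongr
    push_cast
    exact Nat.lt_floor_add_one t

/-- Chebyshev's inequality with deviation `k ξ σ²`: since `k ξ² = log k`, the bound is a constant
over `log k`, which tends to zero while `ξ` does too. -/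
lemma eventually_source_mem_typeClass {σ : ℝ} (hσ : 0 < σ) (μ : Measure ℝ)
    [IsProbabilityMeasure μ] (hμ : MemLp (fun x : ℝ => x ^ 2) 2 μ) (hμσ : ∫ x, x ^ 2 ∂μ = σ ^ 2)
    {ε : ℝ} (hε : 0 < ε) :
    ∀ᶠ k : ℕ in atTop, (iidLaw μ k).real
      {s | ¬ ∃ i : Fin (numTypes k), s ∈ typeClass k (powerLevel σ k) i} ≤ ε := by
  have hlog : Tendsto (fun k : ℕ => Real.log k) atTop atTop :=
    Real.tendsto_log_atTop.comp tendsto_natCast_atTop_atTop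
  have hlim : Tendsto (fun k : ℕ => Var[fun x : ℝ => x ^ 2; μ] / σ ^ 4 / Real.log k) atTop (𝓝 0) :=
    tendsto_const_nhds.div_atTop hlog
  filter_upwards [hlim.eventually (ge_mem_nhds hε), eventually_gt_atTop 1] with k hk hk1
  have hk0 : 0 < k := by omega
  have hk' : (0 : ℝ) < k := by exact_mod_cast hk0
  have hlogk : 0 < Real.log k := Real.log_pos (by exact_mod_cast hk1)
  have hxi : 0 < xi k := Real.sqrt_pos.2 (by positivity)
  have hxi2 : xi k ^ 2 = Real.log k / k := Real.sq_sqrt (by positivity)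
  have h := iidLaw_norm_sq_concentration μ hμ k
    (show 0 < k * (xi k * σ ^ 2) by positivity)
  rw [hμσ] at h
  refine (measureReal_mono fun s hs => ?_).trans (h.trans (le_trans (le_of_eq ?_) hk))
  · by_contra hcon
    exact hs (exists_mem_typeClass hσ hk0 (not_le.1 hcon))
  · rw [mul_pow, mul_pow, hxi2]
    field_simp

/-! ### The sizes of the sub-codebooks -/

lemma distortion_le_iff {k : ℕ} (hk : 0 < k) (s w : Vec k) (D : ℝ) :
    distortion s w ≤ D ↔ ‖s - w‖ ^ 2 ≤ k * D := by
  rw [distortion, div_le_iff₀ (by exact_mod_cast hk), mul_comm]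

lemma norm_sq_toLp_const {k : ℕ} {p : ℝ} (hp : 0 ≤ p) :
    ‖(WithLp.toLp 2 fun _ => Real.sqrt p : Vec k)‖ ^ 2 = k * p := by
  simp [EuclideanSpace.norm_sq_eq, Real.sq_sqrt hp]

lemma sq_eq_codeword_power_add {σ D : ℝ} : σ ^ 2 - D + D = σ ^ 2 := by ring

/-- Exponential bounds for the probability that a source codeword is close to a sequence `s` from
one of the power type classes. -/
lemma eventually_source_ball_le (c : Codebook) {σ D δ : ℝ} (hD : 0 < D) (hDσ : D < σ ^ 2)
    (hδ : 0 < δ) :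
    ∀ᶠ k : ℕ in atTop, ∀ i < numTypes k, ∀ s ∈ typeClass k (powerLevel σ k) i,
      (codewordLaw c (σ ^ 2 - D) k).real {w | distortion s w ≤ D} ≤
        Real.exp (-(k * (Real.log (σ ^ 2 / D) / 2 - δ))) := by
  obtain ⟨η, hη, h⟩ := eventually_codewordLaw_ball_le c (sub_pos.2 hDσ) hD hδ
  rw [sq_eq_codeword_power_add] at h
  filter_upwards [h, eventually_abs_norm_sq_sub_le σ hη, eventually_gt_atTop 0]
    with k h1 h2 hk i hi s hs
  have := isProbabilityMeasure_codewordLaw c (σ ^ 2 - D) hk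
  refine (measureReal_mono fun w hw => ?_).trans (h1 s (h2 i hi s hs))
  have hw : distortion s w ≤ D := hw
  rw [distortion_le_iff hk] at hw
  refine hw.trans ?_
  gcongr
  linarith

lemma eventually_nonExcessProb (c : Codebook) {σ D δ : ℝ} (hD : 0 < D) (hDσ : D < σ ^ 2)
    (hδ : 0 < δ) :
    ∀ᶠ k : ℕ in atTop, ∀ i ≤ numTypes k,
      Real.exp (-(k * (Real.log (σ ^ 2 / D) / 2 + δ))) ≤
        nonExcessProb c σ D k (powerLevel σ k i) ∧
      nonExcessProb c σ D k (powerLevel σ k i) ≤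
        Real.exp (-(k * (Real.log (σ ^ 2 / D) / 2 - δ))) := by
  obtain ⟨η₁, hη₁, h₁⟩ := eventually_codewordLaw_ball_le c (sub_pos.2 hDσ) hD hδ
  obtain ⟨η₂, hη₂, h₂⟩ := eventually_le_codewordLaw_ball c (sub_pos.2 hDσ) hD hδ
  rw [sq_eq_codeword_power_add] at h₁ h₂
  -- The bound by `D` keeps the power level nonnegative, so that its square root has the intended
  -- square.
  have hη : 0 < min (min η₁ η₂) D := by positivity
  filter_upwards [h₁, h₂, eventually_abs_powerLevel_sub_le σ hη, eventually_gt_atTop 0]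
    with k h1 h2 h3 hk i hi
  have := isProbabilityMeasure_codewordLaw c (σ ^ 2 - D) hk
  have h3 := h3 i hi
  have hp : 0 ≤ powerLevel σ k i := by
    have := (abs_le.1 h3).1
    have := min_le_right (min η₁ η₂) D
    linarith
  have hy : |‖(WithLp.toLp 2 fun _ => Real.sqrt (powerLevel σ k i) : Vec k)‖ ^ 2 - k * σ ^ 2| ≤
      k * min (min η₁ η₂) D := by
    rw [norm_sq_toLp_const hp, ← mul_sub, abs_mul, abs_of_nonneg (Nat.cast_nonneg k)]
    gcongr
  constructor
  · refine (h2 _ (hy.trans ?_)).trans (measureReal_mono fun w hw => ?_)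
    · gcongr
      exact (min_le_left _ _).trans (min_le_right _ _)
    · refine (distortion_le_iff hk _ _ _).2 (le_trans hw ?_)
      gcongr
      linarith
  · refine (measureReal_mono fun w hw => ?_).trans (h1 _ (hy.trans ?_))
    · refine ((distortion_le_iff hk _ _ _).1 hw).trans ?_
      gcongr
      linarith
    · gcongr
      exact (min_le_left _ _).trans (min_le_left _ _)

/-- The factor `k` and the rounding contribute only `log k + log 2` to `log M_i`, which is
negligible against `k δ`. -/
lemma eventually_codebookSize (c : Codebook) {σ D δ : ℝ} (hD : 0 < D) (hDσ : D < σ ^ 2)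
    (hδ : 0 < δ) :
    ∀ᶠ k : ℕ in atTop, ∀ i : Fin (numTypes k),
      Real.exp (k * (Real.log (σ ^ 2 / D) / 2 - δ)) ≤ codebookSize c σ D k i ∧
      (codebookSize c σ D k i : ℝ) ≤ Real.exp (k * (Real.log (σ ^ 2 / D) / 2 + δ)) := by
  have hlim : ∀ᶠ k : ℕ in atTop, Real.log k / k < δ / 4 :=
    tendsto_log_div_nat.eventually (gt_mem_nhds (by positivity))
  have hlim2 : ∀ᶠ k : ℕ in atTop, Real.log 2 / k < δ / 4 :=
    (tendsto_const_div_atTop_nhds_zero_nat (Real.log 2)).eventually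
      (gt_mem_nhds (by positivity))
  filter_upwards [eventually_nonExcessProb c hD hDσ (half_pos hδ), hlim, hlim2,
    eventually_gt_atTop 0] with k h hk1 hk2 hk i
  have hk' : (0 : ℝ) < k := by exact_mod_cast hk
  have hk'' : (1 : ℝ) ≤ k := by exact_mod_cast hk
  obtain ⟨h1, h2⟩ := h (i + 1) i.2
  set Ψ := nonExcessProb c σ D k (powerLevel σ k (i + 1)) with hΨ
  have hΨ0 : 0 < Ψ := (Real.exp_pos _).trans_le h1
  set R := Real.log (σ ^ 2 / D) / 2 with hR
  rw [div_lt_iff₀ hk'] at hk1 hk2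
  constructor
  · calc Real.exp (k * (R - δ)) ≤ Real.exp (k * (R - δ / 2)) := by gcongr; linarith
      _ = 1 / Real.exp (-(k * (R - δ / 2))) := by rw [Real.exp_neg, one_div, inv_inv]
      _ ≤ k / Ψ := by gcongr
      _ ≤ _ := Nat.le_ceil _
  · have h3 : Ψ ≤ 1 := by
      have := isProbabilityMeasure_codewordLaw c (σ ^ 2 - D) hk
      exact measureReal_le_one
    have h4 : 1 ≤ k / Ψ := by rw [le_div_iff₀ hΨ0]; linarith
    calc (codebookSize c σ D k i : ℝ) ≤ k / Ψ + 1 := (Nat.ceil_lt_add_one (by positivity)).le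
      _ ≤ 2 * (k / Ψ) := by linarith
      _ ≤ 2 * (k / Real.exp (-(k * (R + δ / 2)))) := by gcongr
      _ = Real.exp (Real.log 2 + Real.log k + k * (R + δ / 2)) := by
          rw [Real.exp_add, Real.exp_add, Real.exp_log two_pos, Real.exp_log hk', Real.exp_neg]
          field_simp
      _ ≤ Real.exp (k * (R + δ)) := by
          refine Real.exp_le_exp.2 ?_
          linarith

/-- The sub-codebooks are large enough to contain a codeword close to the source sequence. -/
lemma eventually_le_codebookSize_mul (c : Codebook) {σ D : ℝ} (hD : 0 < D) (hDσ : D < σ ^ 2) :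
    ∀ᶠ k : ℕ in atTop, ∀ i : Fin (numTypes k), ∀ s ∈ typeClass k (powerLevel σ k) i,
      (k : ℝ) ≤ codebookSize c σ D k i *
        (codewordLaw c (σ ^ 2 - D) k).real {w | distortion s w ≤ D} := by
  filter_upwards [eventually_nonExcessProb c hD hDσ one_pos, eventually_abs_norm_sq_sub_le σ hD,
    eventually_gt_atTop 0] with k h1 h2 hk i s hs
  have hk' : (0 : ℝ) < k := by exact_mod_cast hk
  have := isProbabilityMeasure_codewordLaw c (σ ^ 2 - D) hk
  have h2 := (abs_le.1 (h2 i i.2 s hs)).1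
  set p := powerLevel σ k (i + 1) with hp
  have hΨ0 : 0 < nonExcessProb c σ D k p := (Real.exp_pos _).trans_le (h1 (i + 1) i.2).1
  have hsp : ‖s‖ ^ 2 ≤ k * p := by
    have h3 := hs.2
    rw [div_lt_iff₀ hk'] at h3
    linarith
  have hp0 : 0 ≤ p := by
    by_contra! h
    nlinarith [sq_nonneg ‖s‖]
  have hle : nonExcessProb c σ D k p ≤
      (codewordLaw c (σ ^ 2 - D) k).real {w | distortion s w ≤ D} := by
    simp only [nonExcessProb, distortion_le_iff hk]
    -- The side condition of the monotonicity reads `k (σ² - 2 D) ≤ ‖s‖²`; it follows from `‖s‖² ≥ k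
    -- (σ² - D)`.
    refine ENNReal.toReal_mono (measure_ne_top _ _)
      (codewordLaw_ball_antitone c (sub_pos.2 hDσ) hk ?_ (by nlinarith))
    refine le_of_sq_le_sq ?_ (norm_nonneg _)
    rwa [norm_sq_toLp_const hp0]
  calc (k : ℝ) = k / nonExcessProb c σ D k p * nonExcessProb c σ D k p :=
        (div_mul_cancel₀ _ hΨ0.ne').symm
    _ ≤ _ := mul_le_mul (Nat.le_ceil _) hle hΨ0.le (Nat.cast_nonneg _)

lemma memLp_sq_of_integrable_pow_six (μ : Measure ℝ) [IsProbabilityMeasure μ]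
    (h : Integrable (fun x : ℝ => x ^ 6) μ) : MemLp (fun x : ℝ => x ^ 2) 2 μ := by
  refine (memLp_two_iff_integrable_sq (by fun_prop)).2 ?_
  refine ((integrable_const (1 : ℝ)).add h).mono' (by fun_prop) (ae_of_all _ fun x => ?_)
  rw [Real.norm_of_nonneg (by positivity), Pi.add_apply]
  nlinarith [sq_nonneg (x ^ 2 - 1), sq_nonneg (x * (x ^ 2 - 1)), sq_nonneg (x ^ 2)]

/-! ### Bounds on the excess-distortion probability -/

section Bounds

variable (μS μZ : Measure ℝ) [IsProbabilityMeasure μS] [IsProbabilityMeasure μZ]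
  (cs cc : Codebook) {P σ D : ℝ} {k n : ℕ}

/-- The law of the channel codebook and the noise. -/
abbrev channelLaw (μZ : Measure ℝ) (cs cc : Codebook) (P σ D : ℝ) (k n : ℕ) :
    Measure ((Message (codebookSize cs σ D k) → Vec n) × Vec n) :=
  (Measure.pi fun _ => codewordLaw cc P n).prod (iidLaw μZ n)

lemma measurableSet_exists_typeClass (σ : ℝ) (k : ℕ) :
    MeasurableSet {s : Vec k | ∃ i : Fin (numTypes k), s ∈ typeClass k (powerLevel σ k) i} := by
  have h := MeasurableSet.iUnion fun i : Fin (numTypes k) =>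
    measurableSet_typeClass (k := k) (powerLevel σ k) i
  convert h using 1
  ext s
  simp only [Set.mem_iUnion, Set.mem_ofPred_eq]

lemma excessProb_le (hk : 0 < k) (hn : 0 < n) (hM : ∀ i, 0 < codebookSize cs σ D k i)
    {a b δ : ℝ} (hb : 0 ≤ b + δ)
    (h0 : (iidLaw μS k).real
      {s | ¬ ∃ i : Fin (numTypes k), s ∈ typeClass k (powerLevel σ k) i} ≤ a)
    (h1 : ∀ i : Fin (numTypes k), ∀ s ∈ typeClass k (powerLevel σ k) i,
      (1 - (codewordLaw cs (σ ^ 2 - D) k).real {w | distortion s w ≤ D}) ^ codebookSize cs σ D k i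
        ≤ b)
    (h2 : ∀ m, (channelLaw μZ cs cc P σ D k n).real {p | received p.1 p.2 m ≠ m} ≤ δ) :
    excessProb μS μZ cs cc P σ D k n ≤ a + (b + δ) := by
  have := isProbabilityMeasure_codewordLaw cs (σ ^ 2 - D) hk
  have := isProbabilityMeasure_codewordLaw cc P hn
  have hmeas := (measurableSet_not_excess (k := k) (n := n) (M := codebookSize cs σ D k)
    (monotone_powerLevel σ k) D).compl
  simp only [Set.compl_ofPred, not_not] at hmeas
  refine (prod_real_le_of_sections _ _ hmeas (measurableSet_exists_typeClass σ k).compl hb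
    fun s hs => ?_).trans (add_le_add_left h0 _)
  obtain ⟨i, hi⟩ := not_not.1 hs
  exact (prod_real_excess_le (codewordLaw cs (σ ^ 2 - D) k) (channelLaw μZ cs cc P σ D k n)
    (monotone_powerLevel σ k) hi (hM i) h2).trans (add_le_add_left (h1 i s hi) _)

/-- Source sequences outside all type classes cause an encoder error and so never count as
successes; no estimate of their probability is needed. -/
lemma one_sub_excessProb_le (hk : 0 < k) (hn : 0 < n) (hM : ∀ i, 0 < codebookSize cs σ D k i)
    {p δ : ℝ} (hp : 0 ≤ δ + p)
    (h1 : ∀ i : Fin (numTypes k), ∀ s ∈ typeClass k (powerLevel σ k) i,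
      (codewordLaw cs (σ ^ 2 - D) k).real {w | distortion s w ≤ D} ≤ p)
    (h2 : ∀ (i : Fin (numTypes k)) (j : Fin (codebookSize cs σ D k i)),
      (channelLaw μZ cs cc P σ D k n).real
        {p | received p.1 p.2 (toLex ⟨i, j⟩) = toLex ⟨i, j⟩} ≤ δ) :
    1 - excessProb μS μZ cs cc P σ D k n ≤ δ + p := by
  have := isProbabilityMeasure_codewordLaw cs (σ ^ 2 - D) hk
  have := isProbabilityMeasure_codewordLaw cc P hn
  have hmeas := measurableSet_not_excess (k := k) (n := n) (M := codebookSize cs σ D k)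
    (monotone_powerLevel σ k) D
  have hmeas' := hmeas.compl
  simp only [Set.compl_ofPred, not_not] at hmeas'
  rw [excessProb, ← probReal_compl_eq_one_sub hmeas']
  simp only [Set.compl_ofPred]
  refine (prod_real_le_of_sections _ _ hmeas MeasurableSet.empty hp fun s _ => ?_).trans (by simp)
  by_cases hs : ∃ i : Fin (numTypes k), s ∈ typeClass k (powerLevel σ k) i
  · obtain ⟨i, hi⟩ := hs
    exact (prod_real_not_excess_le (codewordLaw cs (σ ^ 2 - D) k)
      (channelLaw μZ cs cc P σ D k n) (monotone_powerLevel σ k) hi (hM i) (h2 i)).trans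
      (add_le_add_right (h1 i s hi) _)
  · refine le_trans (le_of_eq ?_) hp
    convert measureReal_empty (μ := (Measure.pi fun _ : Message (codebookSize cs σ D k) =>
      codewordLaw cs (σ ^ 2 - D) k).prod (channelLaw μZ cs cc P σ D k n))
    ext q
    simp only [Set.mem_ofPred_eq, Set.mem_empty_iff_false, iff_false, not_not]
    exact excess_of_forall_notMem (fun ⟨i, hi, _⟩ => hs ⟨i, hi⟩) _ _ _

lemma card_message_le {B : ℝ} (hB : ∀ i, (codebookSize cs σ D k i : ℝ) ≤ B) :
    (Fintype.card (Message (codebookSize cs σ D k)) : ℝ) ≤ numTypes k * B := by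
  have h : Fintype.card (Message (codebookSize cs σ D k)) = ∑ i, codebookSize cs σ D k i := by
    rw [show Fintype.card (Message (codebookSize cs σ D k)) =
      Fintype.card (Σ i, Fin (codebookSize cs σ D k i)) from
      Fintype.card_congr ofLex, Fintype.card_sigma]
    simp
  rw [h]
  push_cast
  refine (Finset.sum_le_card_nsmul _ _ _ fun i _ => hB i).trans (le_of_eq ?_)
  simp

end Bounds

/-! ### Asymptotics below and above capacity -/

lemma tendsto_mul_exp_neg {a γ : ℝ} (hγ : 0 < γ) :
    Tendsto (fun n : ℕ => a * n * Real.exp (-(γ * n))) atTop (𝓝 0) := by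
  have h := (Real.tendsto_pow_mul_exp_neg_atTop_nhds_zero 1).comp
    ((tendsto_natCast_atTop_atTop (R := ℝ)).const_mul_atTop hγ)
  have h2 := h.const_mul (a / γ)
  rw [mul_zero] at h2
  refine h2.congr fun n => ?_
  simp only [Function.comp, pow_one]
  field_simp

lemma one_sub_pow_le_exp {p x : ℝ} {N : ℕ} (hp : p ≤ 1) (h : x ≤ N * p) :
    (1 - p) ^ N ≤ Real.exp (-x) := by
  calc (1 - p) ^ N ≤ Real.exp (-p) ^ N :=
        pow_le_pow_left₀ (by linarith) (Real.one_sub_le_exp_neg p) _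
    _ = Real.exp (-(N * p)) := by rw [← Real.exp_nat_mul, mul_neg]
    _ ≤ Real.exp (-x) := Real.exp_le_exp.2 (by linarith)

section Asymptotics

variable {P σ D : ℝ} {μS μZ : Measure ℝ} [IsProbabilityMeasure μS] [IsProbabilityMeasure μZ]

/-- The decoder is reliable below capacity. -/
lemma eventually_received_ne_le (hP : 0 < P) (hD : 0 < D) (hDσ : D < σ ^ 2)
    (hZ : MemLp (fun x : ℝ => x ^ 2) 2 μZ) (hZ2 : ∫ z, z ^ 2 ∂μZ = 1) (cs cc : Codebook) {c ε : ℝ}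
    (hc : 0 < c) (hcC : c * (Real.log (σ ^ 2 / D) / 2) < Real.log (1 + P) / 2) (hε : 0 < ε) :
    ∀ᶠ n : ℕ in atTop, ∀ m,
      (channelLaw μZ cs cc P σ D ⌊c * n⌋₊ n).real {p | received p.1 p.2 m ≠ m} ≤ ε := by
  set R := Real.log (σ ^ 2 / D) / 2 with hR
  set C := Real.log (1 + P) / 2 with hC
  set γ := (C - c * R) / 3 with hγ
  have hγ0 : 0 < γ := by rw [hγ]; linarith
  obtain ⟨η, hη, hball⟩ := eventually_codewordLaw_ball_le cc hP one_pos hγ0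
  -- The first bound makes the difference of two regularizers, at most `4 k δ`, no more than `n η /
  -- 2`, so that it merely enlarges the ball around the output. The second makes the error in the
  -- number of messages cost at most `γ` in the exponent.
  set δ := min (η / (8 * c)) (γ / c) with hδ
  have hδ0 : 0 < δ := by positivity
  have hδ1 : 4 * (c * δ) ≤ η / 2 := by
    have h1 := min_le_left (η / (8 * c)) (γ / c)
    rw [← hδ, le_div_iff₀ (by positivity)] at h1
    linarith
  have hδ2 : c * δ ≤ γ := by
    have h1 := min_le_right (η / (8 * c)) (γ / c)
    rw [← hδ, le_div_iff₀ hc] at h1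
    linarith
  have hk : Tendsto (fun n : ℕ => ⌊c * n⌋₊) atTop atTop :=
    tendsto_nat_floor_atTop.comp (tendsto_natCast_atTop_atTop.const_mul_atTop hc)
  have hlim := (tendsto_mul_exp_neg (a := 2 * c) hγ0).eventually (ge_mem_nhds (half_pos hε))
  filter_upwards [hball, eventually_typicalPairs cc hP μZ hZ hZ2 (half_pos hη) (half_pos hε),
    hk.eventually (eventually_codebookSize cs hD hDσ hδ0), hlim, eventually_gt_atTop 0]
    with n h1 h2 h3 h4 hn
  set k := ⌊c * n⌋₊ with hkdef
  intro m
  have := isProbabilityMeasure_codewordLaw cc P hn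
  have hn0 : (0 : ℝ) ≤ n := Nat.cast_nonneg n
  have hkn : (k : ℝ) ≤ c * n := Nat.floor_le (by positivity)
  have hk0 : (0 : ℝ) ≤ k := Nat.cast_nonneg k
  set β := Real.exp (-(n * (C - γ))) with hβ
  have hlog : ∀ i, |Real.log (codebookSize cs σ D k i) - k * R| ≤ k * δ := by
    intro i
    obtain ⟨h5, h6⟩ := h3 i
    rw [← hR] at h5 h6
    have h7 : (0 : ℝ) < codebookSize cs σ D k i := (Real.exp_pos _).trans_le h5
    have h8 := (Real.le_log_iff_exp_le h7).2 h5
    have h9 := (Real.log_le_iff_le_exp h7).2 h6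
    rw [abs_le]
    constructor <;> linarith
  have : Nonempty (Message (codebookSize cs σ D k)) := ⟨m⟩
  have hfin := argMin_ne_le (codewordLaw cc P n) (iidLaw μZ n)
    (fun m' : Message (codebookSize cs σ D k) =>
      2 * Real.log (codebookSize cs σ D k (ofLex m').1)) m
    (measurableSet_typicalPairs P (η / 2) n) (Real.exp_pos _).le h2 (β := β) (by
      rintro ⟨x₀, z⟩ ⟨hp1, hp2⟩ m'
      have hp1 : |‖x₀ + z‖ ^ 2 - n * (P + 1)| ≤ n * (η / 2) := hp1
      have hp2 : |‖z‖ ^ 2 - n| ≤ n * (η / 2) := hp2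
      have hy := h1 (x₀ + z) (hp1.trans (by gcongr; linarith))
      rw [div_one, add_comm P 1, ← hC] at hy
      refine (measureReal_mono fun x hx => ?_).trans hy
      have hx : ‖x - (x₀ + z)‖ ^ 2 + 2 * Real.log (codebookSize cs σ D k (ofLex m').1) ≤
        ‖z‖ ^ 2 + 2 * Real.log (codebookSize cs σ D k (ofLex m).1) := hx
      change ‖x₀ + z - x‖ ^ 2 ≤ n * (1 + η)
      rw [norm_sub_rev]
      have e1 := (abs_le.1 (hlog (ofLex m').1)).1
      have e2 := (abs_le.1 (hlog (ofLex m).1)).2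
      have e3 := (abs_le.1 hp2).2
      have e4 : (k : ℝ) * δ ≤ c * n * δ := by gcongr
      have e5 : n * (4 * (c * δ)) ≤ n * (η / 2) := by gcongr
      linarith)
  refine hfin.trans ?_
  have hcard := card_message_le cs (fun i => (h3 i).2)
  have hN : (numTypes k : ℝ) ≤ 2 * (c * n) := by
    have : (numTypes k : ℝ) ≤ 2 * k := by exact_mod_cast numTypes_le k
    linarith
  have hRδ : 0 ≤ R + δ := by
    have : 0 ≤ Real.log (σ ^ 2 / D) := Real.log_nonneg ((one_le_div hD).2 hDσ.le)
    rw [hR]; positivity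
  -- The gap `C - c R = 3 γ` pays `γ` for the ball estimate and `γ` for the codebook size; the
  -- remaining `exp (-γ n)` beats the linear number of types.
  have hβ2 : (Fintype.card (Message (codebookSize cs σ D k)) : ℝ) * β ≤ ε / 2 := by
    calc _ ≤ 2 * (c * n) * Real.exp (c * n * (R + δ)) * β := by
          gcongr
          refine hcard.trans ?_
          gcongr
      _ = 2 * c * n * Real.exp (c * n * (R + δ) - n * (C - γ)) := by
          rw [hβ, sub_eq_add_neg (c * n * (R + δ)) (n * (C - γ)), Real.exp_add]; ring
      _ ≤ 2 * c * n * Real.exp (-(γ * n)) := by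
          gcongr
          have e1 : n * (c * δ) ≤ n * γ := by gcongr
          have e2 : (n : ℝ) * (3 * γ) = n * (C - c * R) := by rw [hγ]; ring
          linarith
      _ ≤ ε / 2 := h4
  linarith

/-- Achievability: transmission below capacity has small excess-distortion probability. -/
lemma eventually_excessProb_le (hP : 0 < P) (hσ : 0 < σ) (hD : 0 < D) (hDσ : D < σ ^ 2)
    (hS : MemLp (fun x : ℝ => x ^ 2) 2 μS) (hS2 : ∫ s, s ^ 2 ∂μS = σ ^ 2)
    (hZ : MemLp (fun x : ℝ => x ^ 2) 2 μZ) (hZ2 : ∫ z, z ^ 2 ∂μZ = 1) (cs cc : Codebook) {c ε : ℝ}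
    (hc : 0 < c) (hcC : c * (Real.log (σ ^ 2 / D) / 2) < Real.log (1 + P) / 2) (hε : 0 < ε) :
    ∀ᶠ n : ℕ in atTop, excessProb μS μZ cs cc P σ D ⌊c * n⌋₊ n ≤ ε := by
  have hε3 : 0 < ε / 3 := by positivity
  have hk : Tendsto (fun n : ℕ => ⌊c * n⌋₊) atTop atTop :=
    tendsto_nat_floor_atTop.comp (tendsto_natCast_atTop_atTop.const_mul_atTop hc)
  have hexp : Tendsto (fun k : ℕ => Real.exp (-(k : ℝ))) atTop (𝓝 0) :=
    Real.tendsto_exp_neg_atTop_nhds_zero.comp tendsto_natCast_atTop_atTop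
  filter_upwards [eventually_received_ne_le hP hD hDσ hZ hZ2 cs cc hc hcC hε3,
    hk.eventually (eventually_source_mem_typeClass hσ μS hS hS2 hε3),
    hk.eventually (eventually_codebookSize cs hD hDσ one_pos),
    hk.eventually (eventually_le_codebookSize_mul cs hD hDσ),
    hk.eventually (hexp.eventually (ge_mem_nhds hε3)),
    hk.eventually (eventually_gt_atTop 0), eventually_gt_atTop 0]
    with n h1 h2 h3 h4 h5 hk0 hn
  have := isProbabilityMeasure_codewordLaw cs (σ ^ 2 - D) hk0
  refine (excessProb_le μS μZ cs cc hk0 hn (fun i => ?_) (by positivity) h2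
    (fun i s hs => ?_) h1).trans (by linarith : ε / 3 + (ε / 3 + ε / 3) ≤ ε)
  · exact_mod_cast (Real.exp_pos _).trans_le (h3 i).1
  · exact (one_sub_pow_le_exp measureReal_le_one (h4 i s hs)).trans h5

/-- The decoder fails above capacity. -/
lemma eventually_received_eq_le (hP : 0 < P) (hD : 0 < D) (hDσ : D < σ ^ 2)
    (hZ : MemLp (fun x : ℝ => x ^ 2) 2 μZ) (hZ2 : ∫ z, z ^ 2 ∂μZ = 1) (cs cc : Codebook) {c ε : ℝ}
    (hc : 0 < c) (hcC : Real.log (1 + P) / 2 < c * (Real.log (σ ^ 2 / D) / 2)) (hε : 0 < ε) :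
    ∀ᶠ n : ℕ in atTop, ∀ k : ℕ, c * n ≤ k →
      ∀ (i : Fin (numTypes k)) (j : Fin (codebookSize cs σ D k i)),
      (channelLaw μZ cs cc P σ D k n).real
        {p | received p.1 p.2 (toLex ⟨i, j⟩) = toLex ⟨i, j⟩} ≤ ε := by
  set R := Real.log (σ ^ 2 / D) / 2 with hR
  set C := Real.log (1 + P) / 2 with hC
  set γ := (c * R - C) / 3 with hγ
  have hγ0 : 0 < γ := by rw [hγ]; linarith
  have hC0 : 0 < C := by
    have : 0 < Real.log (1 + P) := Real.log_pos (by linarith)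
    rw [hC]; positivity
  obtain ⟨η, hη, hball⟩ := eventually_le_codewordLaw_ball cc hP one_pos hγ0
  have hcδ : c * (γ / c) = γ := by field_simp
  -- An explicit threshold is needed because the conclusion covers all `k ≥ c n` at once.
  obtain ⟨K, hK⟩ := eventually_atTop.1 (eventually_codebookSize cs hD hDσ (div_pos hγ0 hc))
  have hexp : Tendsto (fun n : ℕ => Real.exp (γ * n)) atTop atTop :=
    Real.tendsto_exp_atTop.comp (tendsto_natCast_atTop_atTop.const_mul_atTop hγ0)
  have hlim : Tendsto (fun n : ℕ => Real.exp (-(Real.exp (γ * n) - 1))) atTop (𝓝 0) :=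
    Real.tendsto_exp_neg_atTop_nhds_zero.comp (tendsto_atTop_add_const_right _ (-1) hexp)
  filter_upwards [hball, eventually_typicalPairs cc hP μZ hZ hZ2 (half_pos hη) (half_pos hε),
    (tendsto_natCast_atTop_atTop.const_mul_atTop hc).eventually (eventually_ge_atTop (K : ℝ)),
    hlim.eventually (ge_mem_nhds (half_pos hε)), eventually_gt_atTop 0]
    with n h1 h2 h3 h4 hn k hkn i j
  have hn' : (0 : ℝ) < n := by exact_mod_cast hn
  have := isProbabilityMeasure_codewordLaw cc P hn
  have hM := (hK k (by exact_mod_cast h3.trans hkn) i).1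
  set β := Real.exp (-(n * (C + γ))) with hβ
  have hβ1 : β ≤ 1 := Real.exp_le_one_iff.2 (by
    have : 0 < n * (C + γ) := by positivity
    linarith)
  have : Nonempty (Message (codebookSize cs σ D k)) := ⟨toLex ⟨i, j⟩⟩
  have hfin := argMin_eq_le (codewordLaw cc P n) (iidLaw μZ n)
    (fun m' : Message (codebookSize cs σ D k) =>
      2 * Real.log (codebookSize cs σ D k (ofLex m').1)) (toLex ⟨i, j⟩)
    -- Competitors of the same type share the regularizer, which then cancels; they alone already
    -- defeat the decoder.
    (s := competitors j) (notMem_competitors j) (by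
      intro m' hm'
      obtain ⟨j', -, rfl⟩ := Finset.mem_map.1 hm'
      rfl)
    (measurableSet_typicalPairs P (η / 2) n) hβ1 h2 (by
      rintro ⟨x₀, z⟩ ⟨hp1, hp2⟩
      have hp1 : |‖x₀ + z‖ ^ 2 - n * (P + 1)| ≤ n * (η / 2) := hp1
      have hp2 : |‖z‖ ^ 2 - n| ≤ n * (η / 2) := hp2
      have hy := h1 (x₀ + z) (hp1.trans (by gcongr; linarith))
      rw [div_one, add_comm P 1, ← hC] at hy
      refine hy.trans (measureReal_mono fun x hx => ?_)
      have hx : ‖x₀ + z - x‖ ^ 2 ≤ n * (1 - η) := hx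
      change ‖x - (x₀ + z)‖ ^ 2 < ‖z‖ ^ 2
      rw [norm_sub_rev]
      have e3 := (abs_le.1 hp2).1
      have e4 : 0 < n * η := by positivity
      linarith)
  refine hfin.trans ?_
  have hpow : (1 - β) ^ (competitors j).card ≤ Real.exp (-(Real.exp (γ * n) - 1)) := by
    refine one_sub_pow_le_exp hβ1 ?_
    have hM1 : 1 ≤ codebookSize cs σ D k i := Fin.pos j
    rw [card_competitors, Nat.cast_sub hM1, Nat.cast_one, sub_mul, one_mul]
    refine sub_le_sub ?_ hβ1
    -- The exponent is `c R - γ - (C + γ) = γ`: one `γ` is lost in the codebook size and one in the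
    -- ball estimate, out of a gap of `3 γ`.
    calc Real.exp (γ * n) = Real.exp (c * n * (R - γ / c)) * β := by
          rw [hβ, ← Real.exp_add]
          congr 1
          have e2 : (n : ℝ) * (3 * γ) = n * (c * R - C) := by rw [hγ]; ring
          linear_combination e2 + (n : ℝ) * hcδ
      _ ≤ codebookSize cs σ D k i * β := by
          gcongr
          refine le_trans (Real.exp_le_exp.2 ?_) hM
          -- The sign of `R - γ / c` allows replacing `c n` by any larger `k`.
          have : 0 ≤ R - γ / c := by
            rw [sub_nonneg, div_le_iff₀ hc]
            linarith
          gcongr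
  linarith

/-- Strong converse: transmission above capacity fails with probability close to one. -/
lemma eventually_lt_excessProb (hP : 0 < P) (hD : 0 < D) (hDσ : D < σ ^ 2)
    (hZ : MemLp (fun x : ℝ => x ^ 2) 2 μZ) (hZ2 : ∫ z, z ^ 2 ∂μZ = 1) (cs cc : Codebook) {c ε : ℝ}
    (hc : 0 < c) (hcC : Real.log (1 + P) / 2 < c * (Real.log (σ ^ 2 / D) / 2)) (hε : ε < 1) :
    ∀ᶠ n : ℕ in atTop, ∀ k : ℕ, c * n ≤ k → ε < excessProb μS μZ cs cc P σ D k n := by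
  set R := Real.log (σ ^ 2 / D) / 2 with hR
  have hR0 : 0 < R := by
    have : 0 < Real.log (σ ^ 2 / D) := Real.log_pos ((one_lt_div hD).2 hDσ)
    rw [hR]; positivity
  set ε' := (1 - ε) / 3 with hε'
  have hε0 : 0 < ε' := by rw [hε']; linarith
  have hexp : Tendsto (fun k : ℕ => Real.exp (-(k * (R - R / 2)))) atTop (𝓝 0) :=
    Real.tendsto_exp_neg_atTop_nhds_zero.comp
      (tendsto_natCast_atTop_atTop.atTop_mul_const (by linarith))
  obtain ⟨K, hK⟩ := eventually_atTop.1 (((eventually_codebookSize cs hD hDσ one_pos).and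
    (eventually_source_ball_le cs hD hDσ (half_pos hR0))).and
    ((hexp.eventually (ge_mem_nhds hε0)).and (eventually_gt_atTop 0)))
  filter_upwards [eventually_received_eq_le hP hD hDσ hZ hZ2 cs cc hc hcC hε0,
    (tendsto_natCast_atTop_atTop.const_mul_atTop hc).eventually (eventually_ge_atTop (K : ℝ)),
    eventually_gt_atTop 0] with n h1 h2 hn k hkn
  obtain ⟨⟨h3, h4⟩, h5, hk⟩ := hK k (by exact_mod_cast h2.trans hkn)
  have h := one_sub_excessProb_le μS μZ cs cc (P := P) hk hn
    (fun i => by exact_mod_cast (Real.exp_pos _).trans_le (h3 i).1) (by positivity)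
    (fun i s hs => (h4 i i.2 s hs).trans h5) (h1 k hkn)
  linarith

end Asymptotics

end NNJSCC

end

/-! ### The limit of `k* / n` -/

theorem mainTheorem4
    (P σ D ε : ℝ) (hP : 0 < P) (hσ : 0 < σ) (hD : 0 < D) (hDσ : D < σ ^ 2)
    (hε : 0 < ε) (hε1 : ε < 1)
    (μS μZ : Measure ℝ) [IsProbabilityMeasure μS] [IsProbabilityMeasure μZ]
    (hS : Integrable (fun s : ℝ => s ^ 6) μS) (hS2 : ∫ s, s ^ 2 ∂μS = σ ^ 2)
    (hZ : Integrable (fun z : ℝ => z ^ 6) μZ) (hZ2 : ∫ z, z ^ 2 ∂μZ = 1)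
    (cs cc : NNJSCC.Codebook) :
    (∀ᶠ n : ℕ in atTop, IsGreatest (NNJSCC.feasible μS μZ cs cc P σ D ε n)
        (NNJSCC.kStar μS μZ cs cc P σ D ε n)) ∧
      Tendsto (fun n : ℕ => (NNJSCC.kStar μS μZ cs cc P σ D ε n : ℝ) / n) atTop
        (𝓝 (NNJSCC.capacity P / NNJSCC.rateDistortion (σ ^ 2) D)) := by
  have hS4 := NNJSCC.memLp_sq_of_integrable_pow_six μS hS
  have hZ4 := NNJSCC.memLp_sq_of_integrable_pow_six μZ hZ
  have hR : 0 < Real.log (σ ^ 2 / D) / 2 := by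
    have : 0 < Real.log (σ ^ 2 / D) := Real.log_pos ((one_lt_div hD).2 hDσ)
    positivity
  have hC : 0 < Real.log (1 + P) / 2 := by
    have : 0 < Real.log (1 + P) := Real.log_pos (by linarith)
    positivity
  rw [NNJSCC.capacity, NNJSCC.rateDistortion, max_eq_left hR.le]
  set L := Real.log (1 + P) / 2 / (Real.log (σ ^ 2 / D) / 2) with hL
  have hL0 : 0 < L := div_pos hC hR
  have lower : ∀ c, 0 < c → c < L → ∀ᶠ n : ℕ in atTop,
      ⌊c * n⌋₊ ∈ NNJSCC.feasible μS μZ cs cc P σ D ε n := by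
    intro c hc hcL
    have hk : Tendsto (fun n : ℕ => ⌊c * n⌋₊) atTop atTop :=
      tendsto_nat_floor_atTop.comp (tendsto_natCast_atTop_atTop.const_mul_atTop hc)
    filter_upwards [NNJSCC.eventually_excessProb_le hP hσ hD hDσ hS4 hS2 hZ4 hZ2 cs cc hc
      ((lt_div_iff₀ hR).1 hcL) hε, hk.eventually (eventually_ge_atTop 1)] with n h1 h2
    exact ⟨h2, h1⟩
  have upper : ∀ c, L < c → ∀ᶠ n : ℕ in atTop,
      ∀ k ∈ NNJSCC.feasible μS μZ cs cc P σ D ε n, (k : ℝ) < c * n := by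
    intro c hcL
    filter_upwards [NNJSCC.eventually_lt_excessProb (μS := μS) hP hD hDσ hZ4 hZ2 cs cc
      (hL0.trans hcL) ((div_lt_iff₀ hR).1 hcL) hε1] with n h1 k hk
    by_contra! hcon
    exact absurd hk.2 (not_le.2 (h1 k hcon))
  have greatest : ∀ᶠ n : ℕ in atTop, IsGreatest (NNJSCC.feasible μS μZ cs cc P σ D ε n)
      (NNJSCC.kStar μS μZ cs cc P σ D ε n) := by
    filter_upwards [lower (L / 2) (by positivity) (by linarith), upper (L + 1) (by linarith)]
      with n h1 h2
    -- A nonempty bounded set of naturals contains its supremum, so `sSup` is a true maximum here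
    -- and not the default value.
    have hbdd : BddAbove (NNJSCC.feasible μS μZ cs cc P σ D ε n) :=
      ⟨⌈(L + 1) * n⌉₊, fun k hk => by exact_mod_cast (h2 k hk).le.trans (Nat.le_ceil _)⟩
    exact ⟨Nat.sSup_mem ⟨_, h1⟩ hbdd, fun k hk => le_csSup hbdd hk⟩
  refine ⟨greatest, tendsto_order.2 ⟨fun a ha => ?_, fun b hb => ?_⟩⟩
  -- Achievability requires a positive `c`, whereas `a` may be negative. Once `(c - a) n > 1`, the
  -- rounding in `⌊c n⌋` is harmless.
  · obtain ⟨c, hc1, hc2⟩ := exists_between (max_lt ha hL0)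
    have hc0 : 0 < c := (le_max_right a 0).trans_lt hc1
    have hac : a < c := (le_max_left a 0).trans_lt hc1
    filter_upwards [greatest, lower c hc0 hc2, (tendsto_natCast_atTop_atTop.const_mul_atTop
      (sub_pos.2 hac)).eventually (eventually_gt_atTop (1 : ℝ)), eventually_gt_atTop 0]
      with n h1 h2 h3 hn
    have hn' : (0 : ℝ) < n := by exact_mod_cast hn
    rw [lt_div_iff₀ hn']
    have h4 : ((⌊c * n⌋₊ : ℕ) : ℝ) ≤ NNJSCC.kStar μS μZ cs cc P σ D ε n := by
      exact_mod_cast h1.2 h2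
    have h5 := Nat.lt_floor_add_one (c * n)
    linarith
  · obtain ⟨c, hc1, hc2⟩ := exists_between hb
    filter_upwards [greatest, upper c hc1, eventually_gt_atTop 0] with n h1 h2 hn
    have hn' : (0 : ℝ) < n := by exact_mod_cast hn
    rw [div_lt_iff₀ hn']
    exact (h2 _ h1.1).trans_le (by gcongr)
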